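/- Let $\mathfrak g$ be a finite-dimensional complex semisimple Lie algebra with Cartan subalgebra $\mathfrak h$, simple roots $\{\alpha_i\}_{i\in I}$, Cartan matrix $a_{ij}=\langle\alpha_j,\alpha_i^\vee\rangle$, and positive integers $d_i$ with $d_ia_{ij}=d_ja_{ji}$; write $(\lambda,\alpha_i)=d_i\langle\lambda,\alpha_i^\vee\rangle$. Let $k$ be a field of characteristic $0$, let $q\in k^\times$ not be a root of unity, and put $q_i=q^{d_i}$. Let $U_q(\mathfrak g)$ be the $k$-algebra with generators $E_i,F_i,K_i^{\pm1}$ $(i\in I)$ and relations $K_iK_i^{-1}=K_i^{-1}K_i=1$, $K_iK_j=K_jK_i$, $K_iE_j=q^{d_ia_{ij}}E_jK_i$, $K_iF_j=q^{-d_ia_{ij}}F_jK_i$, $E_iF_j-F_jE_i=\delta_{ij}\frac{K_i-K_i^{-1}}{q_i-q_i^{-1}}$, and the quantum Serre relations, with the Hopf structure $\Delta(E_i)=E_i\otimes1+K_i\otimes E_i$, $\Delta(F_i)=F_i\otimes K_i^{-1}+1\otimes F_i$, $\Delta(K_i)=K_i\otimes K_i$, so that $S(E_i)=-K_i^{-1}E_i$,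 $S(F_i)=-F_iK_i$, $S(K_i)=K_i^{-1}$. It acts on itself by $\operatorname{ad}_L(a)(b)=a_{(1)}\,b\,S(a_{(2)})$. For $S\subseteq I$ let $U_q(\mathfrak l_S)$ be the subalgebra generated by $E_i,F_i$ $(i\in S)$ and $K_j^{\pm1}$ $(j\in I)$. For $v\in U_q(\mathfrak g)$ put $M(v)=\operatorname{ad}_L(U_q(\mathfrak l_S))\,v$; let $$F_S=\{v\in U_q(\mathfrak g): \dim_k M(v)<\infty\},\qquad [0,M(v)]=\{M(w): w\in F_S,\ M(w)\subseteq M(v)\}.$$ For an integral weight $\lambda\in\mathfrak h^*$ (i.e. $\langle\lambda,\alpha_i^\vee\rangle\in\mathbb Z$ for all $i \in I$) let $V(\lambda)$ be the irreducible $U_q(\mathfrak l_S)$-module of highest weight $\lambda$, on whose highest weight vector $K_j$ acts by $q^{(\lambda,\alpha_j)}$ $(j\in I)$. An embedding of type $\lambda$ is a $U_q(\mathfrak l_S)$-submodule of $U_q(\mathfrak g)$ (for $\operatorname{ad}_L$) isomorphic to $V(\lambda)$. Let $\Lambda_S$ be the set of integral weights $\lambda$ with $\langle\lambda,\alpha_i^\vee\rangle\ge0$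 for all $i\in S$ for which some $v\in F_S$ satisfies $M(v)\cong V(\lambda)$. Let $v\in F_S$. Then the elements of $[0,M(v)]$ are exactly the cyclic $U_q(\mathfrak l_S)$-submodules of $M(v)$ (so that $[0,M(v)]$, ordered by inclusion, is the poset of cyclic submodules of $M(v)$). If moreover $v\neq0$, then $M(v)$ contains an embedding of some type $\lambda\in\Lambda_S$ that is a cyclic adjoint module: there are $\lambda\in\Lambda_S$ and $w\in F_S$ such that $M(w)\subseteq M(v)$, $M(w)$ is irreducible, and $M(w)\cong V(\lambda)$. -/

import Mathlib

open scoped TensorProduct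

namespace QGroup

section SerreElement

variable {k : Type*} [Field k]

/-- The quantum integer `[m]_q = (q ^ m - q ^ (-m)) / (q - q⁻¹)`. -/
def qInt (q : k) (m : ℕ) : k := (q ^ m - q⁻¹ ^ m) / (q - q⁻¹)

/-- The quantum factorial `[m]_q! = [1]_q [2]_q ⋯ [m]_q`. -/
def qFact (q : k) (m : ℕ) : k := ∏ i ∈ Finset.range m, qInt q (i + 1)

/-- The quantum binomial coefficient, for `j ≤ m`. -/
def qBinom (q : k) (m j : ℕ) : k := qFact q m / (qFact q j * qFact q (m - j))

/-- The quantum Serre polynomial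
`∑_{j = 0}^{m} (-1) ^ j [m choose j]_q x ^ (m - j) y x ^ j`. -/
def serrePoly {A : Type*} [Ring A] [Algebra k A] (q : k) (m : ℕ) (x y : A) : A :=
  ∑ j ∈ Finset.range (m + 1), ((-1) ^ j * qBinom q m j) • (x ^ (m - j) * y * x ^ j)

variable {q : k}

theorem qInt_inv (q : k) (m : ℕ) : qInt q⁻¹ m = qInt q m := by
  unfold qInt
  rw [inv_inv, ← neg_sub, ← neg_sub q, neg_div_neg_eq]

theorem qBinom_inv (q : k) (m j : ℕ) : qBinom q⁻¹ m j = qBinom q m j := by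
  simp only [qBinom, qFact, qInt_inv]

theorem sub_inv_ne_zero (hq : q ≠ 0) (hr : ∀ n : ℕ, 0 < n → q ^ n ≠ 1) : q - q⁻¹ ≠ 0 := by
  intro h
  apply hr 2 (by norm_num)
  have : q * (q - q⁻¹) = 0 := by rw [h, mul_zero]
  rw [mul_sub, mul_inv_cancel₀ hq] at this
  rw [pow_two]; exact sub_eq_zero.mp this

theorem qInt_ne_zero (hq : q ≠ 0) (hr : ∀ n : ℕ, 0 < n → q ^ n ≠ 1) (m : ℕ) (hm : 0 < m) :
    qInt q m ≠ 0 := by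
  refine div_ne_zero ?_ (sub_inv_ne_zero hq hr)
  intro h
  apply hr (m + m) (by omega)
  rw [sub_eq_zero] at h
  rw [pow_add]
  nth_rewrite 2 [h]
  rw [← mul_pow, mul_inv_cancel₀ hq, one_pow]

theorem qFact_ne_zero (hq : q ≠ 0) (hr : ∀ n : ℕ, 0 < n → q ^ n ≠ 1) (m : ℕ) :
    qFact q m ≠ 0 :=
  Finset.prod_ne_zero_iff.mpr fun i _ => qInt_ne_zero hq hr _ (Nat.succ_pos i)

theorem qFact_succ (q : k) (m : ℕ) : qFact q (m + 1) = qFact q m * qInt q (m + 1) := by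
  simp [qFact, Finset.prod_range_succ]

theorem qFact_zero (q : k) : qFact q 0 = 1 := by simp [qFact]

theorem qBinom_zero (hq : q ≠ 0) (hr : ∀ n : ℕ, 0 < n → q ^ n ≠ 1) (m : ℕ) :
    qBinom q m 0 = 1 := by
  simp [qBinom, qFact_zero, qFact_ne_zero hq hr m]

theorem qBinom_self (hq : q ≠ 0) (hr : ∀ n : ℕ, 0 < n → q ^ n ≠ 1) (m : ℕ) :
    qBinom q m m = 1 := by
  simp [qBinom, qFact_zero, qFact_ne_zero hq hr m]

/-- The Pascal rule; `m = i + l + 1` and `j = i + 1`. -/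
theorem qBinom_succ (hq : q ≠ 0) (hr : ∀ n : ℕ, 0 < n → q ^ n ≠ 1) (i l : ℕ) :
    q ^ (i + 1) * qBinom q (i + l + 2) (i + 1) =
      qBinom q (i + l + 1) (i + 1) + q ^ (i + l + 2) * qBinom q (i + l + 1) i := by
  have e1 : i + l + 2 - (i + 1) = l + 1 := by omega
  have e2 : i + l + 1 - (i + 1) = l := by omega
  have e3 : i + l + 1 - i = l + 1 := by omega
  simp only [qBinom, e1, e2, e3]
  have h1 := qFact_ne_zero hq hr i
  have h2 := qFact_ne_zero hq hr l
  have h3 := qInt_ne_zero hq hr (i + 1) (by omega)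
  have h4 := qInt_ne_zero hq hr (l + 1) (by omega)
  have key : q ^ (i + 1) * qInt q (i + l + 2) =
      qInt q (l + 1) + q ^ (i + l + 2) * qInt q (i + 1) := by
    have h5 := sub_inv_ne_zero hq hr
    unfold qInt
    rw [← mul_div_assoc, ← mul_div_assoc, ← add_div]
    congr 1
    simp only [pow_add, inv_pow]
    field_simp
    ring
  rw [show i + l + 2 = (i + l + 1) + 1 from rfl, qFact_succ q (i + l + 1), qFact_succ q i,
    qFact_succ q l]
  rw [show i + l + 1 + 1 = i + l + 2 from rfl]
  field_simp
  linear_combination qFact q (i + l + 1) * key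

variable {A : Type*} [Ring A] [Algebra k A]

/-- The product of the operators `u ↦ x u - (z p ^ j) u x`, `0 ≤ j < m`, applied to `y`. -/
def brk (z p : k) (x y : A) : ℕ → A
  | 0 => y
  | m + 1 => x * brk z p x y m - (z * p ^ m) • (brk z p x y m * x)

theorem brk_eq_sum (hq : q ≠ 0) (hr : ∀ n : ℕ, 0 < n → q ^ n ≠ 1) (z : k) (x y : A) (m : ℕ) :
    brk z (q ^ 2) x y m =
      ∑ j ∈ Finset.range (m + 1), ((-1) ^ j * (z ^ j * (q ^ (j * m) * q⁻¹ ^ j) * qBinom q m j)) •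
        (x ^ (m - j) * y * x ^ j) := by
  induction m with
  | zero => simp [brk, qBinom_zero hq hr]
  | succ m ih =>
    set C : ℕ → ℕ → k := fun m j => (-1) ^ j * (z ^ j * (q ^ (j * m) * q⁻¹ ^ j) * qBinom q m j)
      with hC
    have hC0 : ∀ m, C m 0 = 1 := fun m => by simp [hC, qBinom_zero hq hr]
    have hCt : C (m + 1) (m + 1) = -(z * (q ^ 2) ^ m) * C m m := by
      simp only [hC, qBinom_self hq hr]
      simp only [inv_pow, pow_succ, mul_add, add_mul, pow_add, one_mul, mul_one]
      field_simp
      ring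
    have hCs : ∀ j ∈ Finset.range m,
        C (m + 1) (j + 1) = C m (j + 1) - (z * (q ^ 2) ^ m) * C m j := by
      intro j hj
      obtain ⟨l, rfl⟩ : ∃ l, m = j + l + 1 :=
        ⟨m - j - 1, by have := Finset.mem_range.mp hj; omega⟩
      have h := qBinom_succ hq hr j l
      simp only [hC]
      have e : q ^ ((j + 1) * (j + l + 1 + 1)) * q⁻¹ ^ (j + 1) * qBinom q (j + l + 1 + 1) (j + 1) =
          q ^ ((j + 1) * (j + l + 1)) * q⁻¹ ^ (j + 1) *
            (q ^ (j + 1) * qBinom q (j + l + 2) (j + 1)) := by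
        rw [show (j + 1) * (j + l + 1 + 1) = (j + 1) * (j + l + 1) + (j + 1) by ring, pow_add]
        ring
      have e2 : q ^ ((j + 1) * (j + l + 1)) * q⁻¹ ^ (j + 1) * q ^ (j + l + 2) =
          (q ^ 2) ^ (j + l + 1) * (q ^ (j * (j + l + 1)) * q⁻¹ ^ j) := by
        rw [show (j + 1) * (j + l + 1) = j * (j + l + 1) + (j + l + 1) by ring, pow_add,
          ← pow_mul, show 2 * (j + l + 1) = (j + l + 1) + (j + l + 1) by ring,
          pow_add q (j + l + 1) (j + l + 1), show j + l + 2 = (j + l + 1) + 1 from rfl,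
          pow_succ q (j + l + 1), pow_succ q⁻¹ j]
        field_simp
      rw [mul_assoc (z ^ (j + 1)), e, h]
      rw [pow_succ (-1 : k), pow_succ z]
      linear_combination (-((-1) ^ j * z ^ j * z * qBinom q (j + l + 1) j)) * e2
    rw [brk, ih]
    change x * (∑ j ∈ Finset.range (m + 1), C m j • _) -
      _ • ((∑ j ∈ Finset.range (m + 1), C m j • _) * x) =
      ∑ j ∈ Finset.range (m + 1 + 1), C (m + 1) j • (x ^ (m + 1 - j) * y * x ^ j)
    have s0 : ∀ j ∈ Finset.range m,
        C (m + 1) (j + 1) • (x ^ (m + 1 - (j + 1)) * y * x ^ (j + 1)) =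
        (C m (j + 1) - (z * (q ^ 2) ^ m) * C m j) •
          (x ^ (m + 1 - (j + 1)) * y * x ^ (j + 1)) := fun j hj => by rw [hCs j hj]
    rw [Finset.sum_range_succ (fun j => C (m + 1) j • (x ^ (m + 1 - j) * y * x ^ j)) (m + 1),
      Finset.sum_range_succ' (fun j => C (m + 1) j • (x ^ (m + 1 - j) * y * x ^ j)) m,
      Finset.sum_congr rfl s0]
    rw [hCt, hC0]
    have hL : x * (∑ j ∈ Finset.range (m + 1), C m j • (x ^ (m - j) * y * x ^ j)) =
        (∑ j ∈ Finset.range m, x * C m (j + 1) • (x ^ (m - (j + 1)) * y * x ^ (j + 1))) +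
          x * (1 : k) • (x ^ (m - 0) * y * x ^ 0) := by
      rw [Finset.sum_range_succ' _ m, mul_add, Finset.mul_sum, hC0]
    rw [hL, Finset.sum_range_succ _ m, add_mul, Finset.sum_mul]
    simp only [sub_smul, Finset.sum_sub_distrib, smul_add, Finset.smul_sum, mul_smul_comm,
      smul_mul_assoc, one_smul, smul_smul, neg_smul, neg_mul]
    have s1 : ∀ j ∈ Finset.range m, C m (j + 1) • (x * (x ^ (m - (j + 1)) * y * x ^ (j + 1))) =
        C m (j + 1) • (x ^ (m + 1 - (j + 1)) * y * x ^ (j + 1)) := by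
      intro j hj
      have := Finset.mem_range.mp hj
      rw [show m + 1 - (j + 1) = (m - (j + 1)) + 1 by omega, pow_succ' x (m - (j + 1))]
      simp only [mul_assoc]
    have s2 : ∀ j ∈ Finset.range m, (z * (q ^ 2) ^ m * C m j) • (x ^ (m - j) * y * x ^ j * x) =
        (z * (q ^ 2) ^ m * C m j) • (x ^ (m + 1 - (j + 1)) * y * x ^ (j + 1)) := by
      intro j hj
      rw [show m + 1 - (j + 1) = m - j by omega, pow_succ x j]
      simp only [mul_assoc]
    rw [Finset.sum_congr rfl s1, Finset.sum_congr rfl s2]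
    simp only [Nat.sub_self, pow_zero, one_mul, mul_one, Nat.sub_zero, pow_succ', mul_assoc]
    rw [(Commute.pow_self x m).eq]
    abel

theorem serrePoly_eq_brk (hq : q ≠ 0) (hr : ∀ n : ℕ, 0 < n → q ^ n ≠ 1) (m : ℕ) (z : k)
    (hz : z * q ^ m = q) (x y : A) : serrePoly q m x y = brk z (q ^ 2) x y m := by
  rw [brk_eq_sum hq hr, serrePoly]
  refine Finset.sum_congr rfl fun j _ => ?_
  rw [mul_comm j m, pow_mul, ← mul_assoc (z ^ j), ← mul_pow, hz, ← mul_pow,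
    mul_inv_cancel₀ hq, one_pow, one_mul]

theorem serrePoly_eq_brk_inv (hq : q ≠ 0) (hr : ∀ n : ℕ, 0 < n → q ^ n ≠ 1) (m : ℕ) (z : k)
    (hz : z * q = q ^ m) (x y : A) : serrePoly q m x y = brk z (q⁻¹ ^ 2) x y m := by
  have h := serrePoly_eq_brk (q := q⁻¹) (inv_ne_zero hq)
    (fun n hn h => hr n hn (by rwa [inv_pow, inv_eq_one] at h)) m z
    (by rw [inv_pow, ← hz, mul_inv, ← mul_assoc]
        rcases eq_or_ne z 0 with rfl | hz0
        · rw [zero_mul] at hz; exact absurd hz.symm (pow_ne_zero m hq)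
        · rw [mul_inv_cancel₀ hz0, one_mul]) x y
  rw [← h]
  simp only [serrePoly, qBinom_inv]

theorem serrePoly_map {B : Type*} [Ring B] [Algebra k B] (f : A →ₐ[k] B) (q : k) (m : ℕ)
    (x y : A) : f (serrePoly q m x y) = serrePoly q m (f x) (f y) := by
  simp [serrePoly]

theorem serrePoly_add (q : k) (m : ℕ) (x y y' : A) :
    serrePoly q m x (y + y') = serrePoly q m x y + serrePoly q m x y' := by
  simp [serrePoly, mul_add, add_mul, Finset.sum_add_distrib]

/-- Two `q`-commuting elements: only `x` contributes. -/
theorem serrePoly_add_left (hq : q ≠ 0) (hr : ∀ n : ℕ, 0 < n → q ^ n ≠ 1) (m : ℕ) (z : k)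
    (hz : z * q ^ m = q) (x x' y : A) (hx : x' * x = q ^ 2 • (x * x'))
    (hy : x' * y = z • (y * x')) : serrePoly q m (x + x') y = serrePoly q m x y := by
  rw [serrePoly_eq_brk hq hr m z hz, serrePoly_eq_brk hq hr m z hz]
  suffices h : ∀ n, brk z (q ^ 2) (x + x') y n = brk z (q ^ 2) x y n ∧
      x' * brk z (q ^ 2) x y n = (z * (q ^ 2) ^ n) • (brk z (q ^ 2) x y n * x') from (h m).1
  intro n
  induction n with
  | zero => exact ⟨rfl, by simpa [brk] using hy⟩
  | succ n ih =>
    obtain ⟨h1, h2⟩ := ih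
    set u := brk z (q ^ 2) x y n
    refine ⟨?_, ?_⟩
    · rw [brk, brk, h1, add_mul, mul_add, h2, smul_add]
      abel
    · rw [brk]
      change x' * (x * u - _ • (u * x)) = _ • ((x * u - _ • (u * x)) * x')
      have e1 : x' * (x * u) = (z * (q ^ 2) ^ (n + 1)) • (x * u * x') := by
        rw [← mul_assoc, hx, smul_mul_assoc, mul_assoc, h2, mul_smul_comm, smul_smul, mul_assoc]
        congr 1
        ring
      have e2 : x' * (u * x) = (z * (q ^ 2) ^ (n + 1)) • (u * x * x') := by
        rw [← mul_assoc, h2, smul_mul_assoc, mul_assoc, hx, mul_smul_comm, smul_smul, ← mul_assoc]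
        congr 1
        ring
      rw [mul_sub, mul_smul_comm, e1, e2, sub_mul, smul_sub, smul_mul_assoc, smul_comm]

/-- Two `q`-commuting elements: only `x'` contributes. -/
theorem serrePoly_add_right (hq : q ≠ 0) (hr : ∀ n : ℕ, 0 < n → q ^ n ≠ 1) (m : ℕ) (z : k)
    (hz : z * q ^ m = q) (x x' y : A) (hx : x' * x = q ^ 2 • (x * x'))
    (hy : y * x = z • (x * y)) : serrePoly q m (x + x') y = serrePoly q m x' y := by
  have hz0 : z ≠ 0 := by rintro rfl; rw [zero_mul] at hz; exact hq hz.symm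
  have hz' : z⁻¹ * q = q ^ m := by
    nth_rewrite 1 [← hz]
    rw [← mul_assoc, inv_mul_cancel₀ hz0, one_mul]
  have hx' : x * x' = q⁻¹ ^ 2 • (x' * x) := by
    rw [hx, smul_smul, ← mul_pow, inv_mul_cancel₀ hq, one_pow, one_smul]
  rw [serrePoly_eq_brk_inv hq hr m z⁻¹ hz', serrePoly_eq_brk_inv hq hr m z⁻¹ hz']
  suffices h : ∀ n, brk z⁻¹ (q⁻¹ ^ 2) (x + x') y n = brk z⁻¹ (q⁻¹ ^ 2) x' y n ∧
      x * brk z⁻¹ (q⁻¹ ^ 2) x' y n =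
        (z⁻¹ * (q⁻¹ ^ 2) ^ n) • (brk z⁻¹ (q⁻¹ ^ 2) x' y n * x) from (h m).1
  intro n
  induction n with
  | zero =>
    refine ⟨rfl, ?_⟩
    simp only [brk, pow_zero, mul_one]
    rw [hy, smul_smul, inv_mul_cancel₀ hz0, one_smul]
  | succ n ih =>
    obtain ⟨h1, h2⟩ := ih
    set u := brk z⁻¹ (q⁻¹ ^ 2) x' y n
    refine ⟨?_, ?_⟩
    · rw [brk, brk, h1, add_mul, mul_add, h2, smul_add]
      abel
    · rw [brk]
      change x * (x' * u - _ • (u * x')) = _ • ((x' * u - _ • (u * x')) * x)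
      have e1 : x * (x' * u) = (z⁻¹ * (q⁻¹ ^ 2) ^ (n + 1)) • (x' * u * x) := by
        rw [← mul_assoc, hx', smul_mul_assoc, mul_assoc, h2, mul_smul_comm, smul_smul, mul_assoc]
        congr 1
        ring
      have e2 : x * (u * x') = (z⁻¹ * (q⁻¹ ^ 2) ^ (n + 1)) • (u * x' * x) := by
        rw [← mul_assoc, h2, smul_mul_assoc, mul_assoc, hx', mul_smul_comm, smul_smul, ← mul_assoc]
        congr 1
        ring
      rw [mul_sub, mul_smul_comm, e1, e2, sub_mul, smul_sub, smul_mul_assoc, smul_comm]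

/-- The relations are respected by skew primitive elements. -/
theorem serrePoly_coprod (hq : q ≠ 0) (hr : ∀ n : ℕ, 0 < n → q ^ n ≠ 1) (m : ℕ) (z : k)
    (hz : z * q ^ m = q) (x x' y y' : A) (hx : x' * x = q ^ 2 • (x * x'))
    (hy : x' * y = z • (y * x')) (hy' : y' * x = z • (x * y'))
    (h : serrePoly q m x y = 0) (h' : serrePoly q m x' y' = 0) :
    serrePoly q m (x + x') (y + y') = 0 := by
  rw [serrePoly_add, serrePoly_add_left hq hr m z hz x x' y hx hy,
    serrePoly_add_right hq hr m z hz x x' y' hx hy', h, h', add_zero]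

/-- The relations are respected by the antipode. -/
theorem serrePoly_antipode (hq : q ≠ 0) (hr : ∀ n : ℕ, 0 < n → q ^ n ≠ 1) (m : ℕ) (z : k)
    (hz : z * q ^ m = q) (a b : k) (κ κ' x y : A) (hκ : κ * κ' = κ' * κ)
    (h1 : x * κ = q ^ 2 • (κ * x)) (h2 : x * κ' = z • (κ' * x)) (h3 : y * κ = z • (κ * y))
    (h : serrePoly q m x y = 0) :
    serrePoly q m (MulOpposite.op (a • (κ * x))) (MulOpposite.op (b • (κ' * y))) = 0 := by
  have hz0 : z ≠ 0 := by rintro rfl; rw [zero_mul] at hz; exact hq hz.symm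
  have hz' : z⁻¹ * q = q ^ m := by
    nth_rewrite 1 [← hz]
    rw [← mul_assoc, inv_mul_cancel₀ hz0, one_mul]
  rw [serrePoly_eq_brk_inv hq hr m z⁻¹ hz'] at h
  rw [serrePoly_eq_brk hq hr m z hz]
  have hκn : ∀ n, κ ^ n * κ' * κ = κ ^ (n + 1) * κ' := fun n => by
    rw [mul_assoc, ← hκ, ← mul_assoc, pow_succ]
  have hxn : ∀ n, x * (κ ^ n * κ') = (z * (q ^ 2) ^ n) • (κ ^ n * κ' * x) := by
    intro n
    induction n with
    | zero => simpa using h2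
    | succ n ih =>
      rw [pow_succ' κ n, mul_assoc κ, ← mul_assoc, h1, smul_mul_assoc, mul_assoc, ih,
        mul_smul_comm, smul_smul]
      exact congrArg₂ (· • ·) (by ring) (by simp only [mul_assoc])
  have hb : ∀ n, brk z⁻¹ (q⁻¹ ^ 2) x y n * κ =
      (z * (q ^ 2) ^ n) • (κ * brk z⁻¹ (q⁻¹ ^ 2) x y n) := by
    intro n
    induction n with
    | zero => simpa [brk] using h3
    | succ n ih =>
      rw [brk]
      set u := brk z⁻¹ (q⁻¹ ^ 2) x y n
      have e1 : x * u * κ = (z * (q ^ 2) ^ (n + 1)) • (κ * (x * u)) := by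
        rw [mul_assoc, ih, mul_smul_comm, ← mul_assoc, h1, smul_mul_assoc, smul_smul]
        exact congrArg₂ (· • ·) (by ring) (by simp only [mul_assoc])
      have e2 : u * x * κ = (z * (q ^ 2) ^ (n + 1)) • (κ * (u * x)) := by
        rw [mul_assoc, h1, mul_smul_comm, ← mul_assoc, ih, smul_mul_assoc, smul_smul, mul_assoc]
        congr 1
        ring
      rw [sub_mul, smul_mul_assoc, e1, e2, mul_sub, smul_sub, mul_smul_comm, smul_comm]
  suffices hs : ∀ n, ∃ s : k, brk z (q ^ 2) (MulOpposite.op (a • (κ * x)))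
      (MulOpposite.op (b • (κ' * y))) n =
      MulOpposite.op (s • (κ ^ n * κ' * brk z⁻¹ (q⁻¹ ^ 2) x y n)) by
    obtain ⟨s, hs⟩ := hs m
    rw [hs, h, mul_zero, smul_zero, MulOpposite.op_zero]
  intro n
  induction n with
  | zero => exact ⟨b, by simp [brk]⟩
  | succ n ih =>
    obtain ⟨s, hs⟩ := ih
    set c := z * (q ^ 2) ^ n with hc
    have hc0 : c ≠ 0 := mul_ne_zero hz0 (pow_ne_zero _ (pow_ne_zero _ hq))
    have hci : z⁻¹ * (q⁻¹ ^ 2) ^ n = c⁻¹ := by rw [hc, mul_inv, inv_pow, inv_pow]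
    refine ⟨-(s * a * c ^ 2), ?_⟩
    rw [brk, hs, brk, hci, ← MulOpposite.op_mul, ← MulOpposite.op_mul, ← MulOpposite.op_smul,
      ← MulOpposite.op_sub]
    congr 1
    set u := brk z⁻¹ (q⁻¹ ^ 2) x y n
    have e1 : s • (κ ^ n * κ' * u) * a • (κ * x) = (s * a * c) • (κ ^ (n + 1) * κ' * (u * x)) := by
      rw [smul_mul_assoc, mul_smul_comm, smul_smul, mul_assoc _ u, ← mul_assoc u, hb,
        smul_mul_assoc, mul_smul_comm, smul_smul, ← hκn]
      exact congrArg₂ (· • ·) (by ring) (by simp only [u, mul_assoc])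
    have e2 : a • (κ * x) * s • (κ ^ n * κ' * u) = (s * a * c) • (κ ^ (n + 1) * κ' * (x * u)) := by
      rw [smul_mul_assoc, mul_smul_comm, smul_smul, mul_assoc κ, ← mul_assoc x, hxn,
        smul_mul_assoc, mul_smul_comm, smul_smul, pow_succ' κ]
      exact congrArg₂ (· • ·) (by ring) (by simp only [mul_assoc])
    rw [e1, e2, mul_sub, smul_sub, smul_smul, mul_smul_comm, smul_smul]
    have e3 : -(s * a * c ^ 2) * c⁻¹ = -(s * a * c) := by field_simp
    have e4 : c * (s * a * c) = s * a * c ^ 2 := by ring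
    rw [e3, e4, neg_smul, neg_smul]
    abel

theorem serrePoly_commute_mul (q : k) (m : ℕ) (c c' x y : A) (hc : Commute c c')
    (hcx : Commute c x) (hcy : Commute c y) (hcx' : Commute c' x) :
    serrePoly q m (c * x) (c' * y) = c ^ m * c' * serrePoly q m x y := by
  simp only [serrePoly, Finset.mul_sum, mul_smul_comm]
  refine Finset.sum_congr rfl fun j hj => ?_
  have hj : j ≤ m := Nat.lt_succ_iff.mp (Finset.mem_range.mp hj)
  congr 1
  rw [hcx.mul_pow, hcx.mul_pow]
  obtain ⟨l, rfl⟩ := Nat.exists_eq_add_of_le hj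
  rw [Nat.add_sub_cancel_left]
  have h1 : x ^ l * c' = c' * x ^ l := (hcx'.pow_right l).symm.eq
  have h2 : y * c ^ j = c ^ j * y := (hcy.pow_left j).symm.eq
  have h3 : x ^ l * c ^ j = c ^ j * x ^ l := (hcx.pow_pow j l).symm.eq
  have h4 : c' * c ^ j = c ^ j * c' := (hc.pow_left j).symm.eq
  calc c ^ l * x ^ l * (c' * y) * (c ^ j * x ^ j)
      = c ^ l * (x ^ l * c') * (y * c ^ j) * x ^ j := by simp only [mul_assoc]
    _ = c ^ l * c' * (x ^ l * c ^ j) * y * x ^ j := by rw [h1, h2]; simp only [mul_assoc]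
    _ = c ^ l * (c' * c ^ j) * x ^ l * y * x ^ j := by rw [h3]; simp only [mul_assoc]
    _ = c ^ (j + l) * c' * (x ^ l * y * x ^ j) := by
      rw [h4, add_comm, pow_add]; simp only [mul_assoc]

end SerreElement

section Algebra

/-- The data defining a quantized enveloping algebra over `k`: an integral matrix
`A i j = ⟨α_j, α_i^∨⟩` with diagonal entries `2` and nonpositive off-diagonal entries, positive
integers `d i` with `d i * A i j = d j * A j i` (so that `(α_i, α_j) = d i * A i j`), and a nonzero
parameter `q`, not a root of unity. -/
structure Datum (k : Type*) [Field k] (ι : Type*) where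
  A : Matrix ι ι ℤ
  d : ι → ℕ
  q : k
  diag : ∀ i, A i i = 2
  offDiag : ∀ i j, i ≠ j → A i j ≤ 0
  d_pos : ∀ i, 0 < d i
  symm : ∀ i j, (d i : ℤ) * A i j = d j * A j i
  q_ne_zero : q ≠ 0
  q_pow_ne_one : ∀ n : ℕ, 0 < n → q ^ n ≠ 1

/-- Names of the generators `E_i`, `F_i`, `K_i`, `K_i⁻¹`. -/
inductive Gen (ι : Type*)
  | E (i : ι)
  | F (i : ι)
  | K (i : ι)
  | Kinv (i : ι)

variable {k : Type*} [Field k] {ι : Type*} (D : Datum k ι)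

namespace Datum

/-- `q_i = q ^ (d i)`. -/
def qi (i : ι) : k := D.q ^ D.d i

/-- The free generators. -/
def fE (_D : Datum k ι) (i : ι) : FreeAlgebra k (Gen ι) := FreeAlgebra.ι k (Gen.E i)
def fF (_D : Datum k ι) (i : ι) : FreeAlgebra k (Gen ι) := FreeAlgebra.ι k (Gen.F i)
def fK (_D : Datum k ι) (i : ι) : FreeAlgebra k (Gen ι) := FreeAlgebra.ι k (Gen.K i)
def fKinv (_D : Datum k ι) (i : ι) : FreeAlgebra k (Gen ι) := FreeAlgebra.ι k (Gen.Kinv i)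

/-- The defining relations of `U_q(𝔤)`. -/
inductive Rel : FreeAlgebra k (Gen ι) → FreeAlgebra k (Gen ι) → Prop
  | K_mul_Kinv (i : ι) : Rel (D.fK i * D.fKinv i) 1
  | Kinv_mul_K (i : ι) : Rel (D.fKinv i * D.fK i) 1
  | K_mul_K (i j : ι) : Rel (D.fK i * D.fK j) (D.fK j * D.fK i)
  | K_mul_E (i j : ι) :
      Rel (D.fK i * D.fE j) (D.q ^ ((D.d i : ℤ) * D.A i j) • (D.fE j * D.fK i))
  | K_mul_F (i j : ι) :
      Rel (D.fK i * D.fF j) (D.q ^ (-((D.d i : ℤ) * D.A i j)) • (D.fF j * D.fK i))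
  | E_F_same (i : ι) :
      Rel (D.fE i * D.fF i - D.fF i * D.fE i)
        ((D.qi i - (D.qi i)⁻¹)⁻¹ • (D.fK i - D.fKinv i))
  | E_F_ne (i j : ι) (h : i ≠ j) : Rel (D.fE i * D.fF j - D.fF j * D.fE i) 0
  | serre_E (i j : ι) (h : i ≠ j) :
      Rel (serrePoly (D.qi i) (1 - D.A i j).toNat (D.fE i) (D.fE j)) 0
  | serre_F (i j : ι) (h : i ≠ j) :
      Rel (serrePoly (D.qi i) (1 - D.A i j).toNat (D.fF i) (D.fF j)) 0

/-- The quantized enveloping algebra `U_q(𝔤)`. -/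
def U : Type _ := RingQuot D.Rel

noncomputable instance : Ring D.U := inferInstanceAs (Ring (RingQuot D.Rel))
noncomputable instance : Algebra k D.U := inferInstanceAs (Algebra k (RingQuot D.Rel))

/-- The quotient map from the free algebra. -/
noncomputable def proj : FreeAlgebra k (Gen ι) →ₐ[k] D.U := RingQuot.mkAlgHom k D.Rel

theorem proj_rel {x y : FreeAlgebra k (Gen ι)} (h : D.Rel x y) : D.proj x = D.proj y :=
  RingQuot.mkAlgHom_rel k h

/-- The generators of `U_q(𝔤)`. -/
noncomputable def E (i : ι) : D.U := D.proj (D.fE i)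
noncomputable def F (i : ι) : D.U := D.proj (D.fF i)
noncomputable def K (i : ι) : D.U := D.proj (D.fK i)
noncomputable def Kinv (i : ι) : D.U := D.proj (D.fKinv i)

theorem K_mul_Kinv (i : ι) : D.K i * D.Kinv i = 1 := by
  simpa [K, Kinv] using D.proj_rel (.K_mul_Kinv i)

theorem Kinv_mul_K (i : ι) : D.Kinv i * D.K i = 1 := by
  simpa [K, Kinv] using D.proj_rel (.Kinv_mul_K i)

theorem K_mul_K (i j : ι) : D.K i * D.K j = D.K j * D.K i := by
  have h0 := D.proj_rel (.K_mul_K i j)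
  simp only [map_mul] at h0
  exact h0

theorem K_mul_E (i j : ι) :
    D.K i * D.E j = D.q ^ ((D.d i : ℤ) * D.A i j) • (D.E j * D.K i) := by
  have h0 := D.proj_rel (.K_mul_E i j)
  simp only [map_mul, map_smul] at h0
  exact h0

theorem K_mul_F (i j : ι) :
    D.K i * D.F j = D.q ^ (-((D.d i : ℤ) * D.A i j)) • (D.F j * D.K i) := by
  have h0 := D.proj_rel (.K_mul_F i j)
  simp only [map_mul, map_smul] at h0
  exact h0

theorem E_F_same (i : ι) : D.E i * D.F i - D.F i * D.E i =
    (D.qi i - (D.qi i)⁻¹)⁻¹ • (D.K i - D.Kinv i) := by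
  have h0 := D.proj_rel (.E_F_same i)
  simp only [map_mul, map_smul, map_sub] at h0
  exact h0

theorem E_F_ne (i j : ι) (h : i ≠ j) : D.E i * D.F j - D.F j * D.E i = 0 := by
  have h0 := D.proj_rel (.E_F_ne i j h)
  simp only [map_mul, map_sub, map_zero] at h0
  exact h0

theorem serre_E (i j : ι) (h : i ≠ j) :
    serrePoly (D.qi i) (1 - D.A i j).toNat (D.E i) (D.E j) = 0 := by
  have h0 := D.proj_rel (.serre_E i j h)
  simp only [serrePoly_map, map_zero] at h0
  exact h0

theorem serre_F (i j : ι) (h : i ≠ j) :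
    serrePoly (D.qi i) (1 - D.A i j).toNat (D.F i) (D.F j) = 0 := by
  have h0 := D.proj_rel (.serre_F i j h)
  simp only [serrePoly_map, map_zero] at h0
  exact h0

theorem q_zpow_mul (a : ℤ) : D.q ^ a * D.q ^ (-a) = 1 := by
  rw [← zpow_add₀ D.q_ne_zero, add_neg_cancel, zpow_zero]

theorem E_mul_K (i j : ι) :
    D.E j * D.K i = D.q ^ (-((D.d i : ℤ) * D.A i j)) • (D.K i * D.E j) := by
  rw [K_mul_E, smul_smul, mul_comm, q_zpow_mul, one_smul]

theorem F_mul_K (i j : ι) :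
    D.F j * D.K i = D.q ^ ((D.d i : ℤ) * D.A i j) • (D.K i * D.F j) := by
  rw [K_mul_F, smul_smul, q_zpow_mul, one_smul]

theorem Kinv_conj (i : ι) (x : D.U) (c : k) (h : x * D.K i = c • (D.K i * x)) :
    D.Kinv i * x = c • (x * D.Kinv i) := by
  calc D.Kinv i * x = D.Kinv i * (x * D.K i) * D.Kinv i := by
        rw [mul_assoc, mul_assoc, K_mul_Kinv, mul_one]
    _ = c • (D.Kinv i * D.K i * x * D.Kinv i) := by
        rw [h, mul_smul_comm, smul_mul_assoc, mul_assoc, mul_assoc, mul_assoc, mul_assoc]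
    _ = c • (x * D.Kinv i) := by rw [Kinv_mul_K, one_mul]

theorem Kinv_mul_E (i j : ι) :
    D.Kinv i * D.E j = D.q ^ (-((D.d i : ℤ) * D.A i j)) • (D.E j * D.Kinv i) :=
  D.Kinv_conj i _ _ (D.E_mul_K i j)

theorem Kinv_mul_F (i j : ι) :
    D.Kinv i * D.F j = D.q ^ ((D.d i : ℤ) * D.A i j) • (D.F j * D.Kinv i) :=
  D.Kinv_conj i _ _ (D.F_mul_K i j)

theorem E_mul_Kinv (i j : ι) :
    D.E j * D.Kinv i = D.q ^ ((D.d i : ℤ) * D.A i j) • (D.Kinv i * D.E j) := by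
  rw [Kinv_mul_E, smul_smul, q_zpow_mul, one_smul]

theorem Kinv_commute_K (i j : ι) : Commute (D.Kinv i) (D.K j) := by
  have := D.Kinv_conj i (D.K j) 1 (by rw [one_smul, K_mul_K])
  rwa [one_smul] at this

theorem Kinv_commute_Kinv (i j : ι) : Commute (D.Kinv i) (D.Kinv j) := by
  have := D.Kinv_conj i (D.Kinv j) 1 (by rw [one_smul]; exact D.Kinv_commute_K j i)
  rwa [one_smul] at this

theorem qi_ne_zero (i : ι) : D.qi i ≠ 0 := pow_ne_zero _ D.q_ne_zero

theorem qi_pow_ne_one (i : ι) (n : ℕ) (hn : 0 < n) : D.qi i ^ n ≠ 1 := by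
  rw [qi, ← pow_mul]
  exact D.q_pow_ne_one _ (Nat.mul_pos (D.d_pos i) hn)

theorem qi_sq (i : ι) : D.q ^ ((D.d i : ℤ) * D.A i i) = D.qi i ^ 2 := by
  rw [D.diag, qi, ← pow_mul, ← zpow_natCast]
  push_cast
  rfl

theorem serre_exponent (i j : ι) (h : i ≠ j) :
    D.q ^ ((D.d i : ℤ) * D.A i j) * D.qi i ^ (1 - D.A i j).toNat = D.qi i := by
  have h1 : ((1 - D.A i j).toNat : ℤ) = 1 - D.A i j :=
    Int.toNat_of_nonneg (by have := D.offDiag i j h; omega)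
  rw [qi, ← zpow_natCast (D.q ^ D.d i), ← zpow_natCast D.q, ← zpow_mul,
    ← zpow_add₀ D.q_ne_zero, h1]
  congr 1
  ring

theorem F_mul_Kinv (i j : ι) :
    D.F j * D.Kinv i = D.q ^ (-((D.d i : ℤ) * D.A i j)) • (D.Kinv i * D.F j) := by
  rw [Kinv_mul_F, smul_smul, mul_comm, q_zpow_mul, one_smul]

open TensorProduct in
/-- The values of the coproduct on generators:
`Δ(E_i) = E_i ⊗ 1 + K_i ⊗ E_i`, `Δ(F_i) = F_i ⊗ K_i⁻¹ + 1 ⊗ F_i`, `Δ(K_i^{±1}) = K_i^{±1} ⊗ K_i^{±1}`. -/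
noncomputable def comulGen : Gen ι → D.U ⊗[k] D.U
  | .E i => D.E i ⊗ₜ 1 + D.K i ⊗ₜ D.E i
  | .F i => D.F i ⊗ₜ D.Kinv i + 1 ⊗ₜ D.F i
  | .K i => D.K i ⊗ₜ D.K i
  | .Kinv i => D.Kinv i ⊗ₜ D.Kinv i

theorem comulGen_rel {x y : FreeAlgebra k (Gen ι)} (h : D.Rel x y) :
    FreeAlgebra.lift k D.comulGen x = FreeAlgebra.lift k D.comulGen y := by
  have hE : ∀ i, FreeAlgebra.lift k D.comulGen (D.fE i) = D.E i ⊗ₜ 1 + D.K i ⊗ₜ D.E i :=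
    fun i => FreeAlgebra.lift_ι_apply _ _
  have hF : ∀ i, FreeAlgebra.lift k D.comulGen (D.fF i) = D.F i ⊗ₜ D.Kinv i + 1 ⊗ₜ D.F i :=
    fun i => FreeAlgebra.lift_ι_apply _ _
  have hK : ∀ i, FreeAlgebra.lift k D.comulGen (D.fK i) = D.K i ⊗ₜ D.K i :=
    fun i => FreeAlgebra.lift_ι_apply _ _
  have hKi : ∀ i, FreeAlgebra.lift k D.comulGen (D.fKinv i) = D.Kinv i ⊗ₜ D.Kinv i :=
    fun i => FreeAlgebra.lift_ι_apply _ _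
  have hEF : ∀ i j, (D.E i ⊗ₜ[k] (1 : D.U) + D.K i ⊗ₜ D.E i) *
      (D.F j ⊗ₜ D.Kinv j + (1 : D.U) ⊗ₜ D.F j) -
      (D.F j ⊗ₜ D.Kinv j + (1 : D.U) ⊗ₜ D.F j) * (D.E i ⊗ₜ[k] (1 : D.U) + D.K i ⊗ₜ D.E i) =
      (D.E i * D.F j - D.F j * D.E i) ⊗ₜ D.Kinv j +
        D.K i ⊗ₜ (D.E i * D.F j - D.F j * D.E i) := by
    intro i j
    have e : (D.K i * D.F j) ⊗ₜ[k] (D.E i * D.Kinv j) = (D.F j * D.K i) ⊗ₜ (D.Kinv j * D.E i) := by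
      rw [K_mul_F, E_mul_Kinv, TensorProduct.smul_tmul_smul, ← D.symm i j, mul_comm, q_zpow_mul,
        one_smul]
    simp only [add_mul, mul_add, Algebra.TensorProduct.tmul_mul_tmul, one_mul, mul_one,
      TensorProduct.sub_tmul, TensorProduct.tmul_sub, e]
    abel
  induction h with
  | K_mul_Kinv i =>
    rw [map_mul, hK, hKi, map_one, Algebra.TensorProduct.tmul_mul_tmul, K_mul_Kinv,
      Algebra.TensorProduct.one_def]
  | Kinv_mul_K i =>
    rw [map_mul, hK, hKi, map_one, Algebra.TensorProduct.tmul_mul_tmul, Kinv_mul_K,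
      Algebra.TensorProduct.one_def]
  | K_mul_K i j =>
    rw [map_mul, map_mul, hK, hK, Algebra.TensorProduct.tmul_mul_tmul,
      Algebra.TensorProduct.tmul_mul_tmul, K_mul_K]
  | K_mul_E i j =>
    rw [map_smul, map_mul, map_mul, hK, hE]
    simp only [mul_add, add_mul, Algebra.TensorProduct.tmul_mul_tmul, K_mul_E, one_mul, mul_one,
      smul_add, D.K_mul_K i j, TensorProduct.tmul_smul, TensorProduct.smul_tmul']
  | K_mul_F i j =>
    rw [map_smul, map_mul, map_mul, hK, hF]
    simp only [mul_add, add_mul, Algebra.TensorProduct.tmul_mul_tmul, K_mul_F, one_mul, mul_one,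
      smul_add, ← (D.Kinv_commute_K j i).eq, TensorProduct.tmul_smul, TensorProduct.smul_tmul']
  | E_F_same i =>
    rw [map_smul, map_sub, map_sub, map_mul, map_mul, hE, hF, hEF, E_F_same, hK, hKi]
    rw [← TensorProduct.smul_tmul', TensorProduct.tmul_smul, ← smul_add,
      TensorProduct.sub_tmul, TensorProduct.tmul_sub]
    congr 1
    abel
  | E_F_ne i j h =>
    rw [map_zero, map_sub, map_mul, map_mul, hE, hF, hEF, E_F_ne _ _ _ h,
      TensorProduct.zero_tmul, TensorProduct.tmul_zero, add_zero]
  | serre_E i j h =>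
    rw [map_zero, serrePoly_map, hE, hE]
    refine serrePoly_coprod (D.qi_ne_zero i) (D.qi_pow_ne_one i) _ _ (D.serre_exponent i j h)
      _ _ _ _ ?_ ?_ ?_ ?_ ?_
    · simp only [Algebra.TensorProduct.tmul_mul_tmul, one_mul, mul_one, K_mul_E, qi_sq,
        TensorProduct.smul_tmul']
    · simp only [Algebra.TensorProduct.tmul_mul_tmul, one_mul, mul_one, K_mul_E,
        TensorProduct.smul_tmul']
    · simp only [Algebra.TensorProduct.tmul_mul_tmul, one_mul, mul_one, K_mul_E, D.symm i j,
        TensorProduct.smul_tmul']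
    · have := serrePoly_map (Algebra.TensorProduct.includeLeft : D.U →ₐ[k] D.U ⊗[k] D.U)
        (D.qi i) (1 - D.A i j).toNat (D.E i) (D.E j)
      rw [D.serre_E i j h, map_zero] at this
      exact this.symm
    · have := serrePoly_map (Algebra.TensorProduct.includeRight : D.U →ₐ[k] D.U ⊗[k] D.U)
        (D.qi i) (1 - D.A i j).toNat (D.E i) (D.E j)
      rw [D.serre_E i j h, map_zero] at this
      have e : ∀ i, D.K i ⊗ₜ[k] D.E i = (D.K i ⊗ₜ 1) * ((1 : D.U) ⊗ₜ D.E i) := fun i => by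
        rw [Algebra.TensorProduct.tmul_mul_tmul, one_mul, mul_one]
      rw [e, e, serrePoly_commute_mul]
      · exact (congrArg _ this.symm).trans (mul_zero _)
      all_goals
        simp only [Commute, SemiconjBy, Algebra.TensorProduct.tmul_mul_tmul, one_mul, mul_one,
          D.K_mul_K i j]
  | serre_F i j h =>
    rw [map_zero, serrePoly_map, hF, hF, add_comm, add_comm (D.F j ⊗ₜ D.Kinv j)]
    refine serrePoly_coprod (D.qi_ne_zero i) (D.qi_pow_ne_one i) _ _ (D.serre_exponent i j h)
      _ _ _ _ ?_ ?_ ?_ ?_ ?_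
    · simp only [Algebra.TensorProduct.tmul_mul_tmul, one_mul, mul_one, Kinv_mul_F, qi_sq,
        TensorProduct.tmul_smul]
    · simp only [Algebra.TensorProduct.tmul_mul_tmul, one_mul, mul_one, Kinv_mul_F,
        TensorProduct.tmul_smul]
    · simp only [Algebra.TensorProduct.tmul_mul_tmul, one_mul, mul_one, Kinv_mul_F, D.symm i j,
        TensorProduct.tmul_smul]
    · have := serrePoly_map (Algebra.TensorProduct.includeRight : D.U →ₐ[k] D.U ⊗[k] D.U)
        (D.qi i) (1 - D.A i j).toNat (D.F i) (D.F j)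
      rw [D.serre_F i j h, map_zero] at this
      exact this.symm
    · have := serrePoly_map (Algebra.TensorProduct.includeLeft : D.U →ₐ[k] D.U ⊗[k] D.U)
        (D.qi i) (1 - D.A i j).toNat (D.F i) (D.F j)
      rw [D.serre_F i j h, map_zero] at this
      have e : ∀ i, D.F i ⊗ₜ[k] D.Kinv i = ((1 : D.U) ⊗ₜ D.Kinv i) * (D.F i ⊗ₜ 1) := fun i => by
        rw [Algebra.TensorProduct.tmul_mul_tmul, one_mul, mul_one]
      rw [e, e, serrePoly_commute_mul]
      · exact (congrArg _ this.symm).trans (mul_zero _)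
      all_goals
        simp only [Commute, SemiconjBy, Algebra.TensorProduct.tmul_mul_tmul, one_mul, mul_one,
          (D.Kinv_commute_Kinv i j).eq]

open TensorProduct in
/-- The coproduct of `U_q(𝔤)`. -/
noncomputable def comul : D.U →ₐ[k] D.U ⊗[k] D.U :=
  RingQuot.liftAlgHom k ⟨FreeAlgebra.lift k D.comulGen, fun _ _ h => D.comulGen_rel h⟩

/-- The values of the antipode on generators:
`S(E_i) = -K_i⁻¹ E_i`, `S(F_i) = -F_i K_i`, `S(K_i^{±1}) = K_i^{∓1}`. -/
noncomputable def antipodeGen : Gen ι → D.Uᵐᵒᵖ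
  | .E i => MulOpposite.op (-(D.Kinv i * D.E i))
  | .F i => MulOpposite.op (-(D.F i * D.K i))
  | .K i => MulOpposite.op (D.Kinv i)
  | .Kinv i => MulOpposite.op (D.K i)

theorem antipodeGen_rel {x y : FreeAlgebra k (Gen ι)} (h : D.Rel x y) :
    FreeAlgebra.lift k D.antipodeGen x = FreeAlgebra.lift k D.antipodeGen y := by
  have hE : ∀ i, FreeAlgebra.lift k D.antipodeGen (D.fE i) =
      MulOpposite.op (-(D.Kinv i * D.E i)) := fun i => FreeAlgebra.lift_ι_apply _ _
  have hF : ∀ i, FreeAlgebra.lift k D.antipodeGen (D.fF i) =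
      MulOpposite.op (-(D.F i * D.K i)) := fun i => FreeAlgebra.lift_ι_apply _ _
  have hK : ∀ i, FreeAlgebra.lift k D.antipodeGen (D.fK i) = MulOpposite.op (D.Kinv i) :=
    fun i => FreeAlgebra.lift_ι_apply _ _
  have hKi : ∀ i, FreeAlgebra.lift k D.antipodeGen (D.fKinv i) = MulOpposite.op (D.K i) :=
    fun i => FreeAlgebra.lift_ι_apply _ _
  have hEF : ∀ i j, MulOpposite.op (-(D.Kinv i * D.E i)) * MulOpposite.op (-(D.F j * D.K j)) -
      MulOpposite.op (-(D.F j * D.K j)) * MulOpposite.op (-(D.Kinv i * D.E i)) =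
      MulOpposite.op (-(D.Kinv i * (D.E i * D.F j - D.F j * D.E i) * D.K j)) := by
    intro i j
    rw [← MulOpposite.op_mul, ← MulOpposite.op_mul, ← MulOpposite.op_sub]
    congr 1
    have e : D.F j * D.K j * (D.Kinv i * D.E i) = D.Kinv i * (D.F j * D.E i) * D.K j := by
      calc D.F j * D.K j * (D.Kinv i * D.E i)
          = D.F j * (D.Kinv i * D.K j) * D.E i := by
            rw [(D.Kinv_commute_K i j).eq]; simp only [mul_assoc]
        _ = (D.F j * D.Kinv i) * (D.K j * D.E i) := by simp only [mul_assoc]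
        _ = D.Kinv i * (D.F j * D.E i) * D.K j := by
            rw [F_mul_Kinv, K_mul_E, smul_mul_assoc, mul_smul_comm, smul_smul, ← D.symm i j,
              mul_comm (D.q ^ _), q_zpow_mul, one_smul]
            simp only [mul_assoc]
    rw [neg_mul_neg, neg_mul_neg, e, mul_sub, sub_mul, neg_sub]
    simp only [mul_assoc]
  induction h with
  | K_mul_Kinv i =>
    rw [map_mul, hK, hKi, map_one, ← MulOpposite.op_mul, K_mul_Kinv, MulOpposite.op_one]
  | Kinv_mul_K i =>
    rw [map_mul, hK, hKi, map_one, ← MulOpposite.op_mul, Kinv_mul_K, MulOpposite.op_one]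
  | K_mul_K i j =>
    rw [map_mul, map_mul, hK, hK, ← MulOpposite.op_mul, ← MulOpposite.op_mul,
      (D.Kinv_commute_Kinv i j).eq]
  | K_mul_E i j =>
    rw [map_smul, map_mul, map_mul, hK, hE, ← MulOpposite.op_mul, ← MulOpposite.op_mul,
      ← MulOpposite.op_smul]
    congr 1
    rw [neg_mul, mul_neg, smul_neg, mul_assoc, E_mul_Kinv, mul_smul_comm, ← mul_assoc, ← mul_assoc,
      (D.Kinv_commute_Kinv i j).eq]
  | K_mul_F i j =>
    rw [map_smul, map_mul, map_mul, hK, hF, ← MulOpposite.op_mul, ← MulOpposite.op_mul,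
      ← MulOpposite.op_smul]
    congr 1
    rw [neg_mul, mul_neg, smul_neg, mul_assoc, ← (D.Kinv_commute_K i j).eq, ← mul_assoc,
      F_mul_Kinv, smul_mul_assoc, mul_assoc]
  | E_F_same i =>
    rw [map_smul, map_sub, map_sub, map_mul, map_mul, hE, hF, hEF, E_F_same, hK, hKi,
      ← MulOpposite.op_sub, ← MulOpposite.op_smul]
    congr 1
    rw [mul_smul_comm, smul_mul_assoc, ← smul_neg, mul_sub, sub_mul, Kinv_mul_K, one_mul, mul_assoc,
      Kinv_mul_K, mul_one, neg_sub]
  | E_F_ne i j h =>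
    rw [map_zero, map_sub, map_mul, map_mul, hE, hF, hEF, E_F_ne _ _ _ h, mul_zero, zero_mul,
      neg_zero, MulOpposite.op_zero]
  | serre_E i j h =>
    have e : ∀ i, -(D.Kinv i * D.E i) = (-1 : k) • (D.Kinv i * D.E i) := fun i => by
      rw [neg_smul, one_smul]
    rw [map_zero, serrePoly_map, hE, hE, e, e]
    refine serrePoly_antipode (D.qi_ne_zero i) (D.qi_pow_ne_one i) _ _ (D.serre_exponent i j h)
      _ _ _ _ _ _ (D.Kinv_commute_Kinv i j).eq ?_ ?_ ?_ (D.serre_E i j h)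
    · rw [E_mul_Kinv, qi_sq]
    · rw [E_mul_Kinv, D.symm i j]
    · rw [E_mul_Kinv]
  | serre_F i j h =>
    have e : ∀ i, -(D.F i * D.K i) =
        (-D.q ^ ((D.d i : ℤ) * D.A i i)) • (D.K i * D.F i) := fun i => by
      rw [neg_smul, F_mul_K]
    rw [map_zero, serrePoly_map, hF, hF, e, e]
    refine serrePoly_antipode (D.qi_ne_zero i) (D.qi_pow_ne_one i) _ _ (D.serre_exponent i j h)
      _ _ _ _ _ _ (D.K_mul_K i j) ?_ ?_ ?_ (D.serre_F i j h)
    · rw [F_mul_K, qi_sq]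
    · rw [F_mul_K, D.symm i j]
    · rw [F_mul_K]

/-- The antipode of `U_q(𝔤)`, as an algebra homomorphism to the opposite algebra. -/
noncomputable def antipode : D.U →ₐ[k] D.Uᵐᵒᵖ :=
  RingQuot.liftAlgHom k ⟨FreeAlgebra.lift k D.antipodeGen, fun _ _ h => D.antipodeGen_rel h⟩

/-- Right multiplication, `b ↦ (x ↦ x * b)`, as a homomorphism from the opposite algebra. -/
noncomputable def mulRightHom : D.Uᵐᵒᵖ →ₐ[k] Module.End k D.U :=
  Algebra.lsmul k k D.U

/-- The left adjoint action `ad_L(a)(b) = a₍₁₎ b S(a₍₂₎)`: the coproduct followed by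
`a₁ ⊗ a₂ ↦ (b ↦ a₁ b S(a₂))`. -/
noncomputable def ad : D.U →ₐ[k] Module.End k D.U :=
  (Algebra.TensorProduct.lift (Algebra.lmul k D.U) (D.mulRightHom.comp D.antipode)
    (fun a b => LinearMap.ext fun x => by
      simp [mulRightHom, mul_assoc])).comp D.comul

/-- The quantum Levi subalgebra `U_q(𝔩_S)`, generated by `E_i`, `F_i` for `i ∈ S` and by all
`K_j^{±1}`. -/
noncomputable def levi (S : Set ι) : Subalgebra k D.U :=
  Algebra.adjoin k (D.E '' S ∪ D.F '' S ∪ Set.range D.K ∪ Set.range D.Kinv)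

/-- The space `U_q(𝔤)`, as a module over `U_q(𝔤)` (and so over each `U_q(𝔩_S)`) by the left
adjoint action. -/
def Adj : Type _ := D.U

noncomputable instance : AddCommGroup D.Adj := inferInstanceAs (AddCommGroup D.U)
noncomputable instance : Module k D.Adj := inferInstanceAs (Module k D.U)
noncomputable instance : Module (Module.End k D.U) D.Adj :=
  inferInstanceAs (Module (Module.End k D.U) D.U)
noncomputable instance : Module D.U D.Adj := Module.compHom D.Adj D.ad.toRingHom

theorem smul_adj (a : D.U) (b : D.Adj) : a • b = (D.ad a (show D.U from b) : D.U) := rfl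

instance : IsScalarTower k D.U D.Adj where
  smul_assoc c a b := by
    rw [smul_adj, smul_adj, map_smul]
    rfl

/-- The cyclic adjoint module `M(v) = ad_L(U_q(𝔩_S)) v`. -/
noncomputable def M (S : Set ι) (v : D.Adj) : Submodule (D.levi S) D.Adj := Submodule.span (D.levi S) {v}

/-- The relative locally finite part `F_S = {v | dim ad_L(U_q(𝔩_S)) v < ∞}`. -/
def locallyFinite (S : Set ι) : Set D.Adj := {v | FiniteDimensional k (D.M S v)}

/-- The set `𝒫_S = {M(v) | v ∈ F_S}`, ordered by inclusion. -/
def poset (S : Set ι) : Set (Submodule (D.levi S) D.Adj) := D.M S '' D.locallyFinite S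

/-- The interval `[0, M(v)] = {N ∈ 𝒫_S | N ⊆ M(v)}`. -/
def interval (S : Set ι) (v : D.Adj) : Set (Submodule (D.levi S) D.Adj) :=
  {N ∈ D.poset S | N ≤ D.M S v}

/-- `E_i` for `i ∈ S` and `K_j` as elements of the quantum Levi subalgebra. -/
noncomputable def leviE (S : Set ι) (i : S) : D.levi S :=
  ⟨D.E i, Algebra.subset_adjoin (Or.inl (Or.inl (Or.inl ⟨i, i.2, rfl⟩)))⟩
noncomputable def leviK (S : Set ι) (j : ι) : D.levi S :=
  ⟨D.K j, Algebra.subset_adjoin (Or.inl (Or.inr ⟨j, rfl⟩))⟩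

/-- The left ideal of `U_q(𝔩_S)` generated by the `E_i`, `i ∈ S`, and the
`K_j - q ^ (λ, α_j)`, where `λ = ∑ m_j ϖ_j`, so that `(λ, α_j) = d_j m_j`. -/
noncomputable def vermaIdeal (S : Set ι) (m : ι → ℤ) : Submodule (D.levi S) (D.levi S) :=
  Submodule.span (D.levi S) (Set.range (D.leviE S) ∪
    Set.range fun j => D.leviK S j - algebraMap k (D.levi S) (D.q ^ ((D.d j : ℤ) * m j)))

/-- The Verma module of `U_q(𝔩_S)` with highest weight `∑ m_j ϖ_j`. -/
abbrev Verma (S : Set ι) (m : ι → ℤ) : Type _ := D.levi S ⧸ D.vermaIdeal S m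

/-- The irreducible `U_q(𝔩_S)`-module of highest weight `∑ m_j ϖ_j`: the quotient of the Verma
module by the sum of its proper submodules. -/
abbrev V (S : Set ι) (m : ι → ℤ) : Type _ :=
  D.Verma S m ⧸ sSup {N : Submodule (D.levi S) (D.Verma S m) | N ≠ ⊤}

end Datum

end Algebra

section Lie

open LieAlgebra LieAlgebra.IsKilling

variable {𝔤 : Type*} [LieRing 𝔤] [LieAlgebra ℂ 𝔤] [FiniteDimensional ℂ 𝔤]
  [LieAlgebra.IsSemisimple ℂ 𝔤] {H : LieSubalgebra ℂ 𝔤} [H.IsCartanSubalgebra]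
  (b : (rootSystem H).Base)

/-- The data of `U_q(𝔤)`, for a base of the root system, a symmetrizer `d` of the Cartan matrix
(with positive integer entries) and a parameter `q`. -/
noncomputable def datum (d : b.support → ℕ) (hd : ∀ i, 0 < d i)
    (hs : ∀ i j, (d i : ℤ) * b.cartanMatrix j i = d j * b.cartanMatrix i j)
    {k : Type*} [Field k] (q : k) (hq : q ≠ 0) (hr : ∀ n : ℕ, 0 < n → q ^ n ≠ 1) :
    Datum k b.support where
  A i j := b.cartanMatrix j i
  d := d
  q := q
  diag i := b.cartanMatrix_apply_same i
  offDiag i j h := b.cartanMatrix_le_zero_of_ne j i h.symm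
  d_pos := hd
  symm := hs
  q_ne_zero := hq
  q_pow_ne_one := hr

/-- The weight lattice `P = {λ ∈ 𝔥^* | ⟨λ, α_i^∨⟩ ∈ ℤ}`. -/
def weightLattice : AddSubgroup (Module.Dual ℂ H) where
  carrier := {l | ∀ i : b.support, ∃ n : ℤ, l ((rootSystem H).coroot i) = n}
  zero_mem' i := ⟨0, by simp⟩
  add_mem' {x y} hx hy i := by
    obtain ⟨n, hn⟩ := hx i
    obtain ⟨n', hn'⟩ := hy i
    exact ⟨n + n', by rw [LinearMap.add_apply, hn, hn', Int.cast_add]⟩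
  neg_mem' {x} hx i := by
    obtain ⟨n, hn⟩ := hx i
    exact ⟨-n, by rw [LinearMap.neg_apply, hn, Int.cast_neg]⟩

/-- The coordinates `⟨λ, α_i^∨⟩` of a weight in the basis of fundamental weights. -/
noncomputable def coord (l : weightLattice b) (i : b.support) : ℤ := (l.2 i).choose

theorem coord_spec (l : weightLattice b) (i : b.support) :
    (l : Module.Dual ℂ H) ((rootSystem H).coroot i) = coord b l i := (l.2 i).choose_spec

/-- The integral weights that are dominant for `𝔩_S`: `⟨λ, α_i^∨⟩ ≥ 0` for all `i ∈ S`. -/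
def dominantWeights (S : Set b.support) : Set (weightLattice b) := {l | ∀ i ∈ S, 0 ≤ coord b l i}

variable {k : Type*} [Field k] (D : Datum k b.support) (S : Set b.support)

/-- A submodule of `U_q(𝔤)` is an embedding of type `λ` if it is isomorphic to `V(λ)` as a
`U_q(𝔩_S)`-module. -/
def IsEmbeddingOfType (l : weightLattice b) (N : Submodule (D.levi S) D.Adj) : Prop :=
  Nonempty (N ≃ₗ[D.levi S] D.V S (coord b l))

/-- `F_S(λ) = {v ∈ F_S | M(v) ≃ V(λ)}`. -/
def locallyFiniteOfType (l : weightLattice b) : Set D.Adj :=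
  {v ∈ D.locallyFinite S | IsEmbeddingOfType b D S l (D.M S v)}

/-- `Λ_S`, the set of `𝔩_S`-dominant integral weights `λ` with `F_S(λ) ≠ ∅`. -/
def LambdaS : Set (weightLattice b) :=
  {l ∈ dominantWeights b S | (locallyFiniteOfType b D S l).Nonempty}

end Lie

end QGroup

/-! A cyclic submodule of `M(v)` is some `M(w)`, and it inherits finite dimension from `M(v)`; this
gives the description of the interval (`interval_eq`).

For the second claim, a nonzero finite-dimensional `M(v)` contains a simple submodule `P`, with no
appeal to complete reducibility, and the task is to recognise `P` as some `V(λ)`. Each `K_j` acts on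
`U_q(𝔤)` by conjugation, an algebra automorphism that scales the generators by integral powers of
`q_j`. Hence the torus acts diagonalizably over `k` itself, with eigenvalues of the form `q_j ^ m`,
and every stable subspace is a sum of eigenspaces. Nondegeneracy of the Cartan matrix provides a
monomial `t` in the `K_j^{±1}` with `t E_i t⁻¹ = q ^ N E_i` for all `i` and one fixed `N > 0`. It
grades `P`, each `E_i` with `i ∈ S` raises the degree by one, and a joint eigenvector of the `K_j`
in the top degree is a highest weight vector `w` of integral weight. The rank one computation of `E
F ^ (n + 1) w` shows that the weight is dominant on `S` (`exists_highest_weight_vector`).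

Simplicity gives `M(w) = P`, a quotient of a Verma module with maximal kernel. The grading by `t`
shows that the proper submodules of a Verma module have a proper sum (`sSup_proper_ne_top`). This
sum is therefore the kernel, and `P ≅ V(λ)` (`nonempty_equiv_V`). Any integers `m_i` are the
coordinates of a weight because the simple coroots are linearly independent (`exists_coord_eq`). -/

namespace QGroup

/-! ### Eigenspace decompositions of invariant subspaces, without finite dimension. -/

section Eigen

variable {k V : Type*} [Field k] [AddCommGroup V] [Module k V]

/-- The components of an element of an invariant subspace in finitely many eigenspaces lie in the
subspace. -/
theorem mem_of_sum_eigenvectors_mem {α : Type*} {f : Module.End k V} {p : Submodule k V}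
    (hp : ∀ x ∈ p, f x ∈ p) {μ : α → k} (hμ : Function.Injective μ) (s : Finset α) (x : α → V)
    (hx : ∀ a ∈ s, f (x a) = μ a • x a) (hs : ∑ a ∈ s, x a ∈ p) : ∀ a ∈ s, x a ∈ p := by
  classical
  induction s using Finset.induction_on generalizing x with
  | empty => simp
  | insert a s ha ih =>
    -- Applying `f - μ a` kills the component `x a` and multiplies the others by scalars that are
    -- nonzero since `μ` is injective.
    have h1 : ∑ c ∈ s, (μ c - μ a) • x c ∈ p := by
      have h := p.sub_mem (hp _ hs) (p.smul_mem (μ a) hs)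
      rw [map_sum, Finset.smul_sum, ← Finset.sum_sub_distrib, Finset.sum_insert ha,
        hx a (Finset.mem_insert_self _ _), sub_self, zero_add] at h
      convert! h using 1
      refine Finset.sum_congr rfl fun c hc => ?_
      rw [hx c (Finset.mem_insert_of_mem hc), sub_smul]
    have h2 : ∀ c ∈ s, x c ∈ p := by
      intro c hc
      have h := ih (fun c => (μ c - μ a) • x c) (fun c hc => by
        rw [map_smul, hx c (Finset.mem_insert_of_mem hc), smul_comm]) h1 c hc
      refine (p.smul_mem_iff (sub_ne_zero.mpr fun h => ha ?_)).mp h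
      rwa [← hμ h]
    intro c hc
    rcases Finset.mem_insert.mp hc with rfl | hc
    · rw [Finset.sum_insert ha] at hs
      exact (p.add_mem_iff_left (p.sum_mem h2)).mp hs
    · exact h2 c hc

/-- An invariant subspace is the sum of its intersections with the eigenspaces. -/
theorem le_iSup_inf_eigenspace {α : Type*} {f : Module.End k V} {p : Submodule k V}
    (hp : ∀ x ∈ p, f x ∈ p) {μ : α → k} (hμ : Function.Injective μ)
    (h : ⨆ a, f.eigenspace (μ a) = ⊤) : p ≤ ⨆ a, p ⊓ f.eigenspace (μ a) := by
  intro x hx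
  obtain ⟨g, hg, hgx⟩ := (Submodule.mem_iSup_iff_exists_finsupp _ x).mp
    (h ▸ Submodule.mem_top : x ∈ ⨆ a, f.eigenspace (μ a))
  have hs : ∑ a ∈ g.support, g a ∈ p := by
    have : ∑ a ∈ g.support, g a = x := hgx
    rwa [this]
  have h2 := mem_of_sum_eigenvectors_mem hp hμ g.support g
    (fun a _ => Module.End.mem_eigenspace_iff.mp (hg a)) hs
  rw [← hgx]
  exact Submodule.sum_mem _ fun a ha =>
    Submodule.mem_iSup_of_mem a ⟨h2 a ha, hg a⟩

theorem exists_inf_eigenspace_ne_bot {α : Type*} {f : Module.End k V} {p : Submodule k V}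
    (hp : ∀ x ∈ p, f x ∈ p) (hp0 : p ≠ ⊥) {μ : α → k} (hμ : Function.Injective μ)
    (h : ⨆ a, f.eigenspace (μ a) = ⊤) : ∃ a, p ⊓ f.eigenspace (μ a) ≠ ⊥ := by
  by_contra! h0
  refine hp0 (eq_bot_iff.mpr ((le_iSup_inf_eigenspace hp hμ h).trans ?_))
  simp [h0]

/-- Commuting diagonalizable operators have a joint eigenvector in every nonzero subspace that is
invariant under all of them. -/
theorem exists_joint_eigenvector {ι α : Type*} [Finite ι] {f : ι → Module.End k V}
    (hf : ∀ i j x, f i (f j x) = f j (f i x)) {p : Submodule k V}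
    (hp : ∀ i, ∀ x ∈ p, f i x ∈ p) (hp0 : p ≠ ⊥) {μ : ι → α → k}
    (hμ : ∀ i, Function.Injective (μ i)) (h : ∀ i, ⨆ a, (f i).eigenspace (μ i a) = ⊤) :
    ∃ m : ι → α, ∃ x ∈ p, x ≠ 0 ∧ ∀ i, f i x = μ i (m i) • x := by
  classical
  have := Fintype.ofFinite ι
  -- The subspace is cut down by one eigenspace per operator; it stays invariant under all the
  -- operators because they commute.
  have key : ∀ s : Finset ι, ∃ p' ≤ p, p' ≠ ⊥ ∧ (∀ i, ∀ x ∈ p', f i x ∈ p') ∧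
      ∀ i ∈ s, ∃ a, ∀ x ∈ p', f i x = μ i a • x := by
    intro s
    induction s using Finset.induction_on with
    | empty => exact ⟨p, le_rfl, hp0, hp, by simp⟩
    | insert i s hi ih =>
      obtain ⟨p', hle, hne, hst, hs⟩ := ih
      obtain ⟨a, ha⟩ := exists_inf_eigenspace_ne_bot (hst i) hne (hμ i) (h i)
      refine ⟨_, inf_le_left.trans hle, ha, ?_, ?_⟩
      · intro j x hx
        refine ⟨hst j x hx.1, ?_⟩
        rw [SetLike.mem_coe, Module.End.mem_eigenspace_iff, hf,
          Module.End.mem_eigenspace_iff.mp hx.2, map_smul]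
      · intro j hj
        rcases Finset.mem_insert.mp hj with rfl | hj
        · exact ⟨a, fun x hx => Module.End.mem_eigenspace_iff.mp hx.2⟩
        · obtain ⟨c, hc⟩ := hs j hj
          exact ⟨c, fun x hx => hc x hx.1⟩
  obtain ⟨p', hle, hne, -, hs⟩ := key Finset.univ
  obtain ⟨x, hx, hx0⟩ := Submodule.exists_mem_ne_zero_of_ne_bot hne
  choose m hm using fun i => hs i (Finset.mem_univ i)
  exact ⟨m, x, hle hx, hx0, fun i => hm i x hx⟩

theorem zpow_injective_of_pow_ne_one {q : k} (hq : q ≠ 0) (hr : ∀ n : ℕ, 0 < n → q ^ n ≠ 1) :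
    Function.Injective fun n : ℤ => q ^ n := by
  have key : ∀ a b : ℤ, a < b → q ^ a ≠ q ^ b := by
    intro a b hab h
    apply hr (b - a).toNat (by omega)
    rw [← zpow_natCast, Int.toNat_of_nonneg (by omega), zpow_sub₀ hq, h,
      div_self (zpow_ne_zero _ hq)]
  intro a b h
  rcases lt_trichotomy a b with hab | hab | hab
  · exact absurd h (key _ _ hab)
  · exact hab
  · exact absurd h.symm (key _ _ hab)

end Eigen

/-! ### The adjoint action of the torus. -/

namespace Datum

variable {k : Type*} [Field k] {ι : Type*} (D : Datum k ι)

theorem comul_K (j : ι) : D.comul (D.K j) = D.K j ⊗ₜ D.K j :=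
  (RingQuot.liftAlgHom_mkAlgHom_apply k _ _ _).trans (FreeAlgebra.lift_ι_apply _ _)

theorem comul_Kinv (j : ι) : D.comul (D.Kinv j) = D.Kinv j ⊗ₜ D.Kinv j :=
  (RingQuot.liftAlgHom_mkAlgHom_apply k _ _ _).trans (FreeAlgebra.lift_ι_apply _ _)

theorem antipode_K (j : ι) : D.antipode (D.K j) = MulOpposite.op (D.Kinv j) :=
  (RingQuot.liftAlgHom_mkAlgHom_apply k _ _ _).trans (FreeAlgebra.lift_ι_apply _ _)

theorem antipode_Kinv (j : ι) : D.antipode (D.Kinv j) = MulOpposite.op (D.K j) :=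
  (RingQuot.liftAlgHom_mkAlgHom_apply k _ _ _).trans (FreeAlgebra.lift_ι_apply _ _)

/-- Group-like elements act by conjugation. The explicit Hopf structure enters only through this
formula and the one for `Kinv`; everything else uses only that `ad` is an algebra homomorphism. -/
theorem ad_K (j : ι) (x : D.U) : D.ad (D.K j) x = D.K j * x * D.Kinv j := by
  simp only [ad, AlgHom.comp_apply, comul_K]
  simp [mulRightHom, mul_assoc, antipode_K]

theorem ad_Kinv (j : ι) (x : D.U) : D.ad (D.Kinv j) x = D.Kinv j * x * D.K j := by
  simp only [ad, AlgHom.comp_apply, comul_Kinv]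
  simp [mulRightHom, mul_assoc, antipode_Kinv]

theorem generator_induction {P : D.U → Prop} (hE : ∀ i, P (D.E i)) (hF : ∀ i, P (D.F i))
    (hK : ∀ i, P (D.K i)) (hKi : ∀ i, P (D.Kinv i)) (hc : ∀ c : k, P (algebraMap k D.U c))
    (ha : ∀ x y, P x → P y → P (x + y)) (hm : ∀ x y, P x → P y → P (x * y)) (x : D.U) : P x := by
  obtain ⟨y, rfl⟩ : ∃ y, D.proj y = x := RingQuot.mkAlgHom_surjective k D.Rel x
  induction y with
  | grade0 c => rw [AlgHom.commutes]; exact hc c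
  | grade1 g => cases g with
    | E i => exact hE i
    | F i => exact hF i
    | K i => exact hK i
    | Kinv i => exact hKi i
  | mul x y hx hy => rw [map_mul]; exact hm _ _ hx hy
  | add x y hx hy => rw [map_add]; exact ha _ _ hx hy

/-- A multiplicative operator that is diagonal on the generators is diagonalizable. -/
theorem iSup_eigenspace_eq_top {f : Module.End k D.U} (h1 : f 1 = 1)
    (hmul : ∀ x y, f (x * y) = f x * f y) {p : k} (hp : p ≠ 0)
    (hE : ∀ i, ∃ n : ℤ, f (D.E i) = p ^ n • D.E i) (hF : ∀ i, ∃ n : ℤ, f (D.F i) = p ^ n • D.F i)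
    (hK : ∀ i, ∃ n : ℤ, f (D.K i) = p ^ n • D.K i)
    (hKi : ∀ i, ∃ n : ℤ, f (D.Kinv i) = p ^ n • D.Kinv i) :
    ⨆ n : ℤ, f.eigenspace (p ^ n) = ⊤ := by
  have key : ∀ x, (∃ n : ℤ, f x = p ^ n • x) → x ∈ ⨆ n : ℤ, f.eigenspace (p ^ n) :=
    fun x ⟨n, hn⟩ => Submodule.mem_iSup_of_mem n (Module.End.mem_eigenspace_iff.mpr hn)
  suffices h : ∀ x, x ∈ ⨆ n : ℤ, f.eigenspace (p ^ n) from eq_top_iff.mpr fun x _ => h x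
  intro x
  induction x using D.generator_induction with
  | hE i => exact key _ (hE i)
  | hF i => exact key _ (hF i)
  | hK i => exact key _ (hK i)
  | hKi i => exact key _ (hKi i)
  | hc c =>
    rw [Algebra.algebraMap_eq_smul_one]
    exact Submodule.smul_mem _ _ (key _ ⟨0, by rw [h1, zpow_zero, one_smul]⟩)
  | ha x y hx hy => exact Submodule.add_mem _ hx hy
  | hm x y hx hy =>
    -- By bilinearity both factors may be taken to be eigenvectors; then the exponents add.
    induction hx using Submodule.iSup_induction' with
    | zero => rw [zero_mul]; exact Submodule.zero_mem _
    | add a b _ _ ha hb => rw [add_mul]; exact Submodule.add_mem _ ha hb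
    | mem m a ha =>
      induction hy using Submodule.iSup_induction' with
      | zero => rw [mul_zero]; exact Submodule.zero_mem _
      | add b c _ _ hb hc => rw [mul_add]; exact Submodule.add_mem _ hb hc
      | mem n b hb =>
        refine key _ ⟨m + n, ?_⟩
        rw [hmul, Module.End.mem_eigenspace_iff.mp ha, Module.End.mem_eigenspace_iff.mp hb,
          smul_mul_smul_comm, zpow_add₀ hp]

/-- The subalgebra generated by the `K_j^{±1}`. -/
noncomputable def torus : Subalgebra k D.U :=
  Algebra.adjoin k (Set.range D.K ∪ Set.range D.Kinv)

theorem torus_le_levi (S : Set ι) : D.torus ≤ D.levi S := by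
  refine Algebra.adjoin_mono ?_
  rintro x (h | h)
  · exact Or.inl (Or.inr h)
  · exact Or.inr h

theorem commute_of_mem_torus {x : D.U} (hK : ∀ j, Commute (D.K j) x)
    (hKi : ∀ j, Commute (D.Kinv j) x) {t : D.U} (ht : t ∈ D.torus) : Commute t x := by
  induction ht using Algebra.adjoin_induction with
  | mem y hy =>
    rcases hy with ⟨j, rfl⟩ | ⟨j, rfl⟩
    exacts [hK j, hKi j]
  | algebraMap c => exact Algebra.commutes c x
  | add y z _ _ hy hz => exact hy.add_left hz
  | mul y z _ _ hy hz => exact hy.mul_left hz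

theorem commute_K_of_mem_torus {t : D.U} (ht : t ∈ D.torus) (j : ι) : Commute t (D.K j) :=
  D.commute_of_mem_torus (fun i => D.K_mul_K i j) (fun i => D.Kinv_commute_K i j) ht

theorem commute_Kinv_of_mem_torus {t : D.U} (ht : t ∈ D.torus) (j : ι) : Commute t (D.Kinv j) :=
  D.commute_of_mem_torus (fun i => (D.Kinv_commute_K j i).symm)
    (fun i => D.Kinv_commute_Kinv i j) ht

/-- `t` is a monomial in the `K_j^{±1}` with inverse `t'`, and `t E_i t⁻¹ = q ^ (e i) E_i`. -/
structure IsTorusElt (t t' : D.U) (e : ι → ℤ) : Prop where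
  mem : t ∈ D.torus
  inv_mem : t' ∈ D.torus
  mul_inv : t * t' = 1
  inv_mul : t' * t = 1
  ad_apply : ∀ x, D.ad t x = t * x * t'
  mul_E : ∀ i, t * D.E i = D.q ^ e i • (D.E i * t)
  mul_F : ∀ i, t * D.F i = D.q ^ (-e i) • (D.F i * t)

variable {D}

namespace IsTorusElt

variable {t t' s s' : D.U} {e e' : ι → ℤ}

theorem K (j : ι) : D.IsTorusElt (D.K j) (D.Kinv j) fun i => (D.d j : ℤ) * D.A j i where
  mem := Algebra.subset_adjoin (Or.inl ⟨j, rfl⟩)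
  inv_mem := Algebra.subset_adjoin (Or.inr ⟨j, rfl⟩)
  mul_inv := D.K_mul_Kinv j
  inv_mul := D.Kinv_mul_K j
  ad_apply := D.ad_K j
  mul_E := D.K_mul_E j
  mul_F := D.K_mul_F j

theorem Kinv (j : ι) : D.IsTorusElt (D.Kinv j) (D.K j) fun i => -((D.d j : ℤ) * D.A j i) where
  mem := Algebra.subset_adjoin (Or.inr ⟨j, rfl⟩)
  inv_mem := Algebra.subset_adjoin (Or.inl ⟨j, rfl⟩)
  mul_inv := D.Kinv_mul_K j
  inv_mul := D.K_mul_Kinv j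
  ad_apply := D.ad_Kinv j
  mul_E := D.Kinv_mul_E j
  mul_F i := by rw [neg_neg]; exact D.Kinv_mul_F j i

theorem one : D.IsTorusElt 1 1 0 where
  mem := one_mem _
  inv_mem := one_mem _
  mul_inv := mul_one 1
  inv_mul := mul_one 1
  ad_apply x := by simp
  mul_E i := by simp
  mul_F i := by simp

theorem mul (h : D.IsTorusElt t t' e) (h' : D.IsTorusElt s s' e') :
    D.IsTorusElt (t * s) (s' * t') (e + e') where
  mem := mul_mem h.mem h'.mem
  inv_mem := mul_mem h'.inv_mem h.inv_mem
  mul_inv := by rw [mul_assoc, ← mul_assoc s, h'.mul_inv, one_mul, h.mul_inv]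
  inv_mul := by rw [mul_assoc, ← mul_assoc t', h.inv_mul, one_mul, h'.inv_mul]
  ad_apply x := by
    rw [map_mul, Module.End.mul_apply, h'.ad_apply, h.ad_apply]
    simp only [mul_assoc]
  mul_E i := by
    rw [mul_assoc, h'.mul_E, mul_smul_comm, ← mul_assoc, h.mul_E, smul_mul_assoc, smul_smul,
      mul_assoc, ← zpow_add₀ D.q_ne_zero, Pi.add_apply, add_comm (e i)]
  mul_F i := by
    rw [mul_assoc, h'.mul_F, mul_smul_comm, ← mul_assoc, h.mul_F, smul_mul_assoc, smul_smul,
      mul_assoc, ← zpow_add₀ D.q_ne_zero, Pi.add_apply, neg_add_rev]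

theorem exists_nsmul (h : ∃ t t', D.IsTorusElt t t' e) (n : ℕ) :
    ∃ t t', D.IsTorusElt t t' (n • e) := by
  induction n with
  | zero => exact ⟨1, 1, by rw [zero_smul]; exact one⟩
  | succ n ih =>
    obtain ⟨t, t', ht⟩ := h
    obtain ⟨s, s', hs⟩ := ih
    exact ⟨_, _, by rw [succ_nsmul]; exact hs.mul ht⟩

theorem exists_zsmul (j : ι) (c : ℤ) :
    ∃ t t', D.IsTorusElt t t' (c • fun i => (D.d j : ℤ) * D.A j i) := by
  obtain ⟨n, rfl | rfl⟩ := c.eq_nat_or_neg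
  · rw [natCast_zsmul]
    exact exists_nsmul ⟨_, _, K j⟩ n
  · rw [neg_smul, natCast_zsmul, ← smul_neg]
    exact exists_nsmul ⟨_, _, Kinv j⟩ n

theorem exists_sum [Fintype ι] (c : ι → ℤ) :
    ∃ t t', D.IsTorusElt t t' (∑ j, c j • fun i => (D.d j : ℤ) * D.A j i) := by
  classical
  induction (Finset.univ : Finset ι) using Finset.induction_on with
  | empty => exact ⟨1, 1, one⟩
  | insert j s hj ih =>
    obtain ⟨t, t', ht⟩ := exists_zsmul (D := D) j (c j)
    obtain ⟨s, s', hs⟩ := ih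
    exact ⟨_, _, by rw [Finset.sum_insert hj]; exact ht.mul hs⟩

/-- The base `p` is left free so that the lemma serves both the grading element, with `p = q ^ N`,
and `K_j`, with `p = q_j`. The `K_i^{±1}` have exponent zero, since the torus is commutative. -/
theorem iSup_eigenspace_eq_top (h : D.IsTorusElt t t' e) {p : k} (hp : p ≠ 0)
    (he : ∀ i, ∃ n : ℤ, D.q ^ e i = p ^ n) :
    ⨆ n : ℤ, (Algebra.lsmul k k D.Adj t).eigenspace (p ^ n) = ⊤ := by
  refine D.iSup_eigenspace_eq_top (f := D.ad t) ?_ ?_ hp ?_ ?_ ?_ ?_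
  · rw [h.ad_apply, mul_one, h.mul_inv]
  · intro x y
    simp only [h.ad_apply]
    calc t * (x * y) * t' = t * x * 1 * y * t' := by simp only [mul_one, mul_assoc]
      _ = _ := by rw [← h.inv_mul]; simp only [mul_assoc]
  · intro i
    obtain ⟨n, hn⟩ := he i
    exact ⟨n, by rw [h.ad_apply, h.mul_E, smul_mul_assoc, mul_assoc, h.mul_inv, mul_one, hn]⟩
  · intro i
    obtain ⟨n, hn⟩ := he i
    exact ⟨-n, by rw [h.ad_apply, h.mul_F, smul_mul_assoc, mul_assoc, h.mul_inv, mul_one,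
      zpow_neg, hn, zpow_neg]⟩
  · intro i
    exact ⟨0, by rw [h.ad_apply, (D.commute_K_of_mem_torus h.mem i).eq, mul_assoc, h.mul_inv,
      mul_one, zpow_zero, one_smul]⟩
  · intro i
    exact ⟨0, by rw [h.ad_apply, (D.commute_Kinv_of_mem_torus h.mem i).eq, mul_assoc, h.mul_inv,
      mul_one, zpow_zero, one_smul]⟩

end IsTorusElt

/-! ### Rank one computation and existence of highest weight vectors. -/

section HighestWeight

theorem K_smul_F_pow_smul {i : ι} {m : ℤ} {w : D.Adj} (hK : D.K i • w = D.qi i ^ m • w) (n : ℕ) :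
    D.K i • D.F i ^ n • w = D.qi i ^ (m - 2 * n) • D.F i ^ n • w := by
  induction n with
  | zero => simpa using hK
  | succ n ih =>
    rw [pow_succ', mul_smul, ← mul_smul (D.K i), K_mul_F, smul_assoc, mul_smul, ih, smul_comm,
      smul_smul, smul_comm (D.F i), neg_mul_eq_mul_neg]
    congr 1
    rw [D.diag, qi, ← zpow_natCast, ← zpow_mul, ← zpow_mul, ← zpow_add₀ D.q_ne_zero]
    congr 1
    push_cast
    ring

theorem Kinv_smul_of_K_smul {i : ι} {c : k} (hc : c ≠ 0) {w : D.Adj} (hK : D.K i • w = c • w) :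
    D.Kinv i • w = c⁻¹ • w := by
  rw [eq_inv_smul_iff₀ hc, smul_comm, ← hK, ← mul_smul, Kinv_mul_K, one_smul]

/-- The coefficient is `[n + 1] [m - n]` for the parameter `q_i`, written out because `m - n` may be
negative whereas `qInt` takes a natural number. -/
theorem E_smul_F_pow_succ_smul {i : ι} {m : ℤ} {w : D.Adj} (hE : D.E i • w = 0)
    (hK : D.K i • w = D.qi i ^ m • w) (n : ℕ) :
    D.E i • D.F i ^ (n + 1) • w = ((D.qi i - (D.qi i)⁻¹)⁻¹ ^ 2 *
      (D.qi i ^ (n + 1) - (D.qi i)⁻¹ ^ (n + 1)) * (D.qi i ^ (m - n) - D.qi i ^ (-(m - n)))) •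
        D.F i ^ n • w := by
  have hq := D.qi_ne_zero i
  have h0 : D.qi i - (D.qi i)⁻¹ ≠ 0 := sub_inv_ne_zero hq (D.qi_pow_ne_one i)
  have key : ∀ n : ℕ, D.E i • D.F i ^ (n + 1) • w = D.F i • D.E i • D.F i ^ n • w +
      ((D.qi i - (D.qi i)⁻¹)⁻¹ * (D.qi i ^ (m - 2 * n) - D.qi i ^ (-(m - 2 * n)))) •
        D.F i ^ n • w := by
    intro n
    have h1 : D.E i * D.F i = D.F i * D.E i + (D.qi i - (D.qi i)⁻¹)⁻¹ • (D.K i - D.Kinv i) := by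
      rw [← D.E_F_same, add_sub_cancel]
    have h2 := K_smul_F_pow_smul hK n
    have h3 := Kinv_smul_of_K_smul (zpow_ne_zero _ hq) h2
    rw [pow_succ', mul_smul, ← mul_smul (D.E i), h1, add_smul, mul_smul, smul_assoc, sub_smul, h2,
      h3, ← sub_smul, mul_smul (D.qi i - (D.qi i)⁻¹)⁻¹, zpow_neg]
  induction n with
  | zero =>
    rw [key, pow_zero, one_smul, hE, smul_zero, zero_add]
    congr 1
    simp only [zero_add, pow_one, Nat.cast_zero, mul_zero, sub_zero]
    field_simp
  | succ n ih =>
    rw [key, ih, smul_comm, ← mul_smul (D.F i), ← pow_succ', ← add_smul]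
    -- The remaining identity is `[n + 1] [m - n] + [m - 2n - 2] = [n + 2] [m - n - 1]`; it becomes
    -- rational in `q_i`, `q_i ^ n` and `q_i ^ m`.
    congr 1
    have e1 : D.qi i ^ (m - 2 * ((n + 1 : ℕ) : ℤ)) = D.qi i ^ m * (D.qi i ^ n)⁻¹ ^ 2 *
        (D.qi i)⁻¹ ^ 2 := by
      rw [zpow_sub₀ hq, zpow_mul, Nat.cast_succ, div_eq_mul_inv, zpow_add₀ (zpow_ne_zero _ hq),
        zpow_natCast, zpow_one, mul_inv, mul_assoc]
      norm_cast
      rw [← pow_mul, ← inv_pow, ← inv_pow, ← inv_pow, ← pow_mul, mul_comm 2 n]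
    have e2 : D.qi i ^ (m - (n : ℤ)) = D.qi i ^ m * (D.qi i ^ n)⁻¹ := by
      rw [zpow_sub₀ hq, zpow_natCast, div_eq_mul_inv]
    have e3 : D.qi i ^ (m - ((n + 1 : ℕ) : ℤ)) = D.qi i ^ m * (D.qi i ^ n)⁻¹ * (D.qi i)⁻¹ := by
      rw [zpow_sub₀ hq, zpow_natCast, div_eq_mul_inv, pow_succ, mul_inv, mul_assoc]
    rw [zpow_neg, zpow_neg, zpow_neg, e1, e2, e3]
    simp only [pow_succ, pow_zero, inv_pow, mul_inv, inv_inv, one_mul]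
    have ha : D.qi i ^ m ≠ 0 := zpow_ne_zero _ hq
    have hb : D.qi i ^ n ≠ 0 := pow_ne_zero _ hq
    generalize D.qi i ^ m = a at *
    generalize D.qi i ^ n = b at *
    generalize D.qi i = c at *
    field_simp
    ring

/-- The highest weight of a finite-dimensional module is dominant. -/
theorem nonneg_of_F_pow_smul_eq_zero {i : ι} {m : ℤ} {w : D.Adj} (hw : w ≠ 0)
    (hE : D.E i • w = 0) (hK : D.K i • w = D.qi i ^ m • w) {r : ℕ} (hr : D.F i ^ r • w = 0) :
    0 ≤ m := by
  classical
  have hex : ∃ r, D.F i ^ r • w = 0 := ⟨r, hr⟩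
  obtain ⟨n, hn⟩ : ∃ n, Nat.find hex = n + 1 := Nat.exists_eq_succ_of_ne_zero fun h => by
    have := Nat.find_spec hex
    rw [h, pow_zero, one_smul] at this
    exact hw this
  have h1 : D.F i ^ (n + 1) • w = 0 := hn ▸ Nat.find_spec hex
  have h2 : D.F i ^ n • w ≠ 0 := Nat.find_min hex (by omega)
  -- Here `F ^ n w ≠ 0` and `F ^ (n + 1) w = 0`, so `[n + 1] [m - n] = 0`. As `[n + 1] ≠ 0`, this
  -- forces `m = n`.
  have h3 := E_smul_F_pow_succ_smul hE hK n
  rw [h1, smul_zero] at h3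
  have h4 := (smul_eq_zero.mp h3.symm).resolve_right h2
  have hq := D.qi_ne_zero i
  have h0 : D.qi i - (D.qi i)⁻¹ ≠ 0 := sub_inv_ne_zero hq (D.qi_pow_ne_one i)
  have h5 := qInt_ne_zero hq (D.qi_pow_ne_one i) (n + 1) n.succ_pos
  have h6 : D.qi i ^ (n + 1) - (D.qi i)⁻¹ ^ (n + 1) ≠ 0 := fun h => h5 (by rw [qInt, h, zero_div])
  have h7 := (mul_eq_zero.mp h4).resolve_left
    (mul_ne_zero (pow_ne_zero _ (inv_ne_zero h0)) h6)
  have h8 := zpow_injective_of_pow_ne_one hq (D.qi_pow_ne_one i) (sub_eq_zero.mp h7)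
  omega

/-- The eigenspaces of `t` grade `P` by integers. Finite dimension leaves finitely many degrees, and
the top one is killed by the `E_i` and stable under the `K_j`. -/
theorem exists_highest_weight_vector [Finite ι] {S : Set ι} {t t' : D.U} {N : ℤ} (hN : 0 < N)
    (ht : D.IsTorusElt t t' fun _ => N) (P : Submodule (D.levi S) D.Adj)
    [FiniteDimensional k P] (hP : P ≠ ⊥) :
    ∃ m : ι → ℤ, ∃ w ∈ P, w ≠ 0 ∧ (∀ i ∈ S, D.E i • w = 0) ∧
      (∀ j, D.K j • w = D.q ^ ((D.d j : ℤ) * m j) • w) ∧ ∀ i ∈ S, 0 ≤ m i := by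
  have hq := D.q_ne_zero
  set p : k := D.q ^ N with hpdef
  have hp0 : p ≠ 0 := zpow_ne_zero _ hq
  have hqinj := zpow_injective_of_pow_ne_one hq D.q_pow_ne_one
  have hpinj : Function.Injective fun n : ℤ => p ^ n := by
    intro a b hab
    simp only [hpdef, ← zpow_mul] at hab
    exact mul_left_cancel₀ hN.ne' (hqinj hab)
  have hst : ∀ a ∈ D.levi S, ∀ x ∈ P, a • x ∈ P := fun a ha x hx => P.smul_mem ⟨a, ha⟩ hx
  have htS : ∀ s ∈ D.torus, s ∈ D.levi S := fun s hs => D.torus_le_levi S hs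
  have hKS : ∀ j, D.K j ∈ D.levi S := fun j => htS _ (IsTorusElt.K j).mem
  let T : Module.End k D.Adj := Algebra.lsmul k k D.Adj t
  have hTtop : ⨆ n : ℤ, T.eigenspace (p ^ n) = ⊤ :=
    ht.iSup_eigenspace_eq_top hp0 fun i => ⟨1, (zpow_one p).symm⟩
  let P' : Submodule k D.Adj := P.restrictScalars k
  have hP' : P' ≠ ⊥ := by rwa [ne_eq, Submodule.restrictScalars_eq_bot_iff]
  let Z : ℤ → Submodule k D.Adj := fun n => P' ⊓ T.eigenspace (p ^ n)
  have hZ : ∀ n x, x ∈ Z n ↔ x ∈ P ∧ t • x = p ^ n • x := fun n x => by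
    rw [Submodule.mem_inf, Module.End.mem_eigenspace_iff]; rfl
  -- Eigenspaces for distinct eigenvalues are independent, and a finite-dimensional space has only
  -- finitely many nonzero independent subspaces.
  have hfin : {n | Z n ≠ ⊥}.Finite := by
    have : FiniteDimensional k P' := ‹FiniteDimensional k P›
    let T' : Module.End k P' := T.restrict (hst t (htS t ht.mem))
    have hind : iSupIndep fun n : ℤ => T'.eigenspace (p ^ n) :=
      T'.eigenspaces_iSupIndep.comp (f := fun n : ℤ => p ^ n) hpinj
    refine (WellFoundedGT.finite_ne_bot_of_iSupIndep hind).subset fun n hn h => hn ?_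
    rw [eq_bot_iff]
    intro x hx
    have : (⟨x, hx.1⟩ : P') ∈ T'.eigenspace (p ^ n) :=
      Module.End.mem_eigenspace_iff.mpr (Subtype.ext (Module.End.mem_eigenspace_iff.mp hx.2))
    rw [h, Submodule.mem_bot] at this
    exact congrArg Subtype.val this
  obtain ⟨n, hn, hmax⟩ := hfin.exists_maximal
    (exists_inf_eigenspace_ne_bot (hst t (htS t ht.mem)) hP' hpinj hTtop)
  have hEZ : ∀ i ∈ S, ∀ x ∈ Z n, D.E i • x = 0 := by
    intro i hi x hx
    have h1 : D.E i • x ∈ Z (n + 1) := by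
      rw [hZ] at hx ⊢
      refine ⟨hst _ (D.leviE S ⟨i, hi⟩).2 _ hx.1, ?_⟩
      rw [← mul_smul, ht.mul_E, smul_assoc, mul_smul, hx.2, smul_comm (D.E i), smul_smul,
        ← zpow_one_add₀ hp0, add_comm]
    by_contra h0
    have h2 : n + 1 ∈ {n | Z n ≠ ⊥} := fun h => h0 (by rwa [h, Submodule.mem_bot] at h1)
    have := hmax h2 (by omega)
    omega
  -- Powers of `q_j`, rather than of `q`, suffice as eigenvalues of `K_j`, because `q ^ (d_j A_ji) =
  -- q_j ^ A_ji`. This is what makes the weight integral.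
  obtain ⟨m, w, hw, hw0, hm⟩ := exists_joint_eigenvector (ι := ι)
    (f := fun j => Algebra.lsmul k k D.Adj (D.K j)) (p := Z n)
    (μ := fun j n => (D.q ^ D.d j) ^ n)
    (fun i j x => by
      simp only [Algebra.lsmul_coe, ← mul_smul, D.K_mul_K i j])
    (fun j x hx => by
      rw [hZ] at hx ⊢
      refine ⟨hst _ (hKS j) _ hx.1, ?_⟩
      rw [Algebra.lsmul_coe, ← mul_smul, (D.commute_K_of_mem_torus ht.mem j).eq, mul_smul, hx.2,
        smul_comm]) hn
    (fun j => zpow_injective_of_pow_ne_one (D.qi_ne_zero j) (D.qi_pow_ne_one j))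
    (fun j => (IsTorusElt.K j).iSup_eigenspace_eq_top (D.qi_ne_zero j) fun i =>
      ⟨D.A j i, by rw [← zpow_natCast, ← zpow_mul]⟩)
  have hF : ∀ i ∈ S, ∀ r : ℕ, D.F i ^ r • w ∈ Z (n - r) := by
    intro i hi r
    induction r with
    | zero => simpa using hw
    | succ r ih =>
      rw [hZ] at ih ⊢
      rw [pow_succ', mul_smul]
      refine ⟨hst _ (Algebra.subset_adjoin (Or.inl (Or.inl (Or.inr ⟨i, hi, rfl⟩)))) _ ih.1, ?_⟩
      rw [← mul_smul, ht.mul_F, smul_assoc, mul_smul, ih.2, smul_comm (D.F i), smul_smul,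
        zpow_neg, ← zpow_neg_one, ← zpow_add₀ hp0]
      congr 2
      push_cast
      ring
  have hK : ∀ j, D.K j • w = D.qi j ^ m j • w := hm
  refine ⟨m, w, ((hZ _ _).mp hw).1, hw0, fun i hi => hEZ i hi w hw, fun j => ?_, fun i hi => ?_⟩
  · rw [hK, qi, ← zpow_natCast, ← zpow_mul]
  -- The vector `F_i ^ r w` has degree `n - r`, and only finitely many degrees occur; so some power
  -- of `F_i` kills `w`.
  · obtain ⟨r, hr⟩ : ∃ r : ℕ, Z (n - r) = ⊥ := by
      by_contra! h
      refine (Set.infinite_range_of_injective (f := fun r : ℕ => n - (r : ℤ)) ?_) (hfin.subset ?_)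
      · intro a b hab
        simpa using hab
      · rintro _ ⟨r, rfl⟩
        exact h r
    refine nonneg_of_F_pow_smul_eq_zero hw0 (hEZ i hi w hw) (hK i) (r := r) ?_
    have := hF i hi r
    rwa [hr, Submodule.mem_bot] at this

end HighestWeight

/-! ### The largest proper submodule of a highest weight module. -/

section MaximalSubmodule

variable (D) (S : Set ι)

/-- `F_i` for `i ∈ S` and `K_j⁻¹` as elements of the quantum Levi subalgebra. -/
noncomputable def leviF (i : S) : D.levi S :=
  ⟨D.F i, Algebra.subset_adjoin (Or.inl (Or.inl (Or.inr ⟨i, i.2, rfl⟩)))⟩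
noncomputable def leviKinv (j : ι) : D.levi S :=
  ⟨D.Kinv j, Algebra.subset_adjoin (Or.inr ⟨j, rfl⟩)⟩

variable {V : Type*} [AddCommGroup V] [Module (D.levi S) V]

/-- The vector `F_{i₁} ⋯ F_{iᵣ} v`. -/
noncomputable def wordVec (v : V) (l : List S) : V := (l.map (D.leviF S)).prod • v

theorem wordVec_cons (v : V) (i : S) (l : List S) :
    D.wordVec S v (i :: l) = D.leviF S i • D.wordVec S v l := by
  simp [wordVec, mul_smul]

variable {D S}
variable [Module k V] [IsScalarTower k (D.levi S) V]

theorem levi_induction {P : D.levi S → Prop} (hE : ∀ i, P (D.leviE S i))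
    (hF : ∀ i, P (D.leviF S i)) (hK : ∀ j, P (D.leviK S j)) (hKi : ∀ j, P (D.leviKinv S j))
    (hc : ∀ c : k, P (algebraMap k (D.levi S) c)) (ha : ∀ x y, P x → P y → P (x + y))
    (hm : ∀ x y, P x → P y → P (x * y)) (x : D.levi S) : P x := by
  obtain ⟨x, hx⟩ := x
  induction hx using Algebra.adjoin_induction with
  | mem y hy =>
    rcases hy with ((⟨i, hi, rfl⟩ | ⟨i, hi, rfl⟩) | ⟨j, rfl⟩) | ⟨j, rfl⟩
    exacts [hE ⟨i, hi⟩, hF ⟨i, hi⟩, hK j, hKi j]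
  | algebraMap c => exact hc c
  | add y z hy' hz' hy hz => exact ha ⟨y, hy'⟩ ⟨z, hz'⟩ hy hz
  | mul y z hy' hz' hy hz => exact hm ⟨y, hy'⟩ ⟨z, hz'⟩ hy hz

theorem leviKinv_smul_of_leviK_smul {v : V} {j : ι} (h : ∃ c : k, D.leviK S j • v = c • v) :
    ∃ c : k, D.leviKinv S j • v = c • v := by
  obtain ⟨c, hc⟩ := h
  have h1 : D.leviKinv S j * D.leviK S j = 1 := Subtype.ext (D.Kinv_mul_K j)
  have h2 : v = c • D.leviKinv S j • v := by
    rw [smul_comm, ← hc, ← mul_smul, h1, one_smul]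
  rcases eq_or_ne c 0 with rfl | h0
  · rw [zero_smul] at h2
    exact ⟨0, by rw [h2, smul_zero, smul_zero]⟩
  · exact ⟨c⁻¹, by rw [eq_inv_smul_iff₀ h0, ← h2]⟩

theorem leviK_smul_wordVec {v : V} (hK : ∀ j, ∃ c : k, D.leviK S j • v = c • v) (l : List S)
    (j : ι) : ∃ c : k, D.leviK S j • D.wordVec S v l = c • D.wordVec S v l := by
  induction l with
  | nil => simpa [wordVec] using hK j
  | cons i l ih =>
    obtain ⟨c, hc⟩ := ih
    have h1 : D.leviK S j * D.leviF S i =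
        D.q ^ (-((D.d j : ℤ) * D.A j i)) • (D.leviF S i * D.leviK S j) :=
      Subtype.ext (D.K_mul_F j i)
    rw [wordVec_cons]
    exact ⟨_, by rw [← mul_smul, h1, smul_assoc, mul_smul, hc, smul_comm (D.leviF S i), smul_smul]⟩

/-- A highest weight module is spanned by the vectors `F_{i₁} ⋯ F_{iᵣ} v`. -/
theorem span_wordVec_eq_top {v : V} (hv : Submodule.span (D.levi S) {v} = ⊤)
    (hE : ∀ i, D.leviE S i • v = 0) (hK : ∀ j, ∃ c : k, D.leviK S j • v = c • v) :
    Submodule.span k (Set.range (D.wordVec S v)) = ⊤ := by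
  set Q := Submodule.span k (Set.range (D.wordVec S v))
  have hmem : ∀ l, D.wordVec S v l ∈ Q := fun l => Submodule.subset_span ⟨l, rfl⟩
  have hQ : ∀ a : D.levi S, (∀ l, a • D.wordVec S v l ∈ Q) → ∀ x ∈ Q, a • x ∈ Q := by
    intro a ha x hx
    induction hx using Submodule.span_induction with
    | mem x hx => obtain ⟨l, rfl⟩ := hx; exact ha l
    | zero => rw [smul_zero]; exact Q.zero_mem
    | add x y _ _ hx hy => rw [smul_add]; exact Q.add_mem hx hy
    | smul c x _ hx => rw [smul_comm]; exact Q.smul_mem c hx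
  have hQF : ∀ i, ∀ x ∈ Q, D.leviF S i • x ∈ Q := fun i =>
    hQ _ fun l => by rw [← wordVec_cons]; exact hmem _
  have hQK : ∀ j, ∀ x ∈ Q, D.leviK S j • x ∈ Q := fun j => hQ _ fun l => by
    obtain ⟨c, hc⟩ := leviK_smul_wordVec hK l j
    rw [hc]; exact Q.smul_mem c (hmem l)
  have hQKi : ∀ j, ∀ x ∈ Q, D.leviKinv S j • x ∈ Q := fun j => hQ _ fun l => by
    obtain ⟨c, hc⟩ := leviKinv_smul_of_leviK_smul (leviK_smul_wordVec hK l j)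
    rw [hc]; exact Q.smul_mem c (hmem l)
  -- Induction on the word: `E_j` is moved past the leftmost `F_i`, and the commutator lies in the
  -- torus, which acts on words by scalars.
  have hQE : ∀ i, ∀ x ∈ Q, D.leviE S i • x ∈ Q := fun j => hQ _ fun l => by
    induction l with
    | nil =>
      have : D.leviE S j • D.wordVec S v [] = 0 := by simpa [wordVec] using hE j
      rw [this]; exact Q.zero_mem
    | cons i l ih =>
      rw [wordVec_cons, ← mul_smul]
      by_cases hij : j = i
      · subst hij
        have h : D.leviE S j * D.leviF S j = D.leviF S j * D.leviE S j +
            (D.qi j - (D.qi j)⁻¹)⁻¹ • (D.leviK S j - D.leviKinv S j) :=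
          Subtype.ext (eq_add_of_sub_eq' (D.E_F_same j))
        rw [h, add_smul, mul_smul, smul_assoc, sub_smul]
        exact Q.add_mem (hQF j _ ih)
          (Q.smul_mem _ (Q.sub_mem (hQK _ _ (hmem l)) (hQKi _ _ (hmem l))))
      · have h : D.leviE S j * D.leviF S i = D.leviF S i * D.leviE S j :=
          Subtype.ext (sub_eq_zero.mp (D.E_F_ne j i fun h => hij (Subtype.ext h)))
        rw [h, mul_smul]
        exact hQF i _ ih
  have hQall : ∀ a : D.levi S, ∀ x ∈ Q, a • x ∈ Q := by
    intro a
    induction a using D.levi_induction with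
    | hE i => exact hQE i
    | hF i => exact hQF i
    | hK j => exact hQK j
    | hKi j => exact hQKi j
    | hc c => intro x hx; rw [algebraMap_smul]; exact Q.smul_mem c hx
    | ha a b ha hb => intro x hx; rw [add_smul]; exact Q.add_mem (ha x hx) (hb x hx)
    | hm a b ha hb => intro x hx; rw [mul_smul]; exact ha _ (hb x hx)
  refine eq_top_iff.mpr fun x _ => ?_
  obtain ⟨a, rfl⟩ := Submodule.mem_span_singleton.mp (hv ▸ Submodule.mem_top : x ∈ _)
  exact hQall a v (by simpa [wordVec] using hmem [])

/-- Needed for the grading element, which is only known to lie in the torus. -/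
theorem torus_smul {v : V} (hK : ∀ j, ∃ c : k, D.leviK S j • v = c • v) {t : D.U}
    (ht : t ∈ D.torus) : ∃ c : k, (⟨t, D.torus_le_levi S ht⟩ : D.levi S) • v = c • v := by
  induction ht using Algebra.adjoin_induction with
  | mem y hy =>
    rcases hy with ⟨j, rfl⟩ | ⟨j, rfl⟩
    exacts [hK j, leviKinv_smul_of_leviK_smul (hK j)]
  | algebraMap c => exact ⟨c, algebraMap_smul (D.levi S) c v⟩
  | add y z hy' hz' hy hz =>
    obtain ⟨a, ha⟩ := hy
    obtain ⟨b, hb⟩ := hz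
    exact ⟨a + b, by rw [add_smul, ← ha, ← hb, ← add_smul]; rfl⟩
  | mul y z hy' hz' hy hz =>
    obtain ⟨a, ha⟩ := hy
    obtain ⟨b, hb⟩ := hz
    exact ⟨b * a, by rw [mul_smul, ← ha, smul_comm, ← hb, ← mul_smul]; rfl⟩

/-- The proper submodules of a highest weight module have a proper sum. -/
theorem sSup_proper_ne_top {t t' : D.U} {N : ℤ} (hN : 0 < N)
    (ht : D.IsTorusElt t t' fun _ => N) {v : V} (hv0 : v ≠ 0)
    (hv : Submodule.span (D.levi S) {v} = ⊤) (hE : ∀ i, D.leviE S i • v = 0)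
    (hK : ∀ j, ∃ c : k, D.leviK S j • v = c • v) :
    sSup {P : Submodule (D.levi S) V | P ≠ ⊤} ≠ ⊤ := by
  obtain ⟨μ, hμ⟩ := torus_smul hK ht.mem
  set τ : D.levi S := ⟨t, D.torus_le_levi S ht.mem⟩
  have hμ0 : μ ≠ 0 := by
    rintro rfl
    have h₁ : (⟨t', D.torus_le_levi S ht.inv_mem⟩ : D.levi S) * τ = 1 := Subtype.ext ht.inv_mul
    apply hv0
    rw [← one_smul (D.levi S) v, ← h₁, mul_smul, hμ, zero_smul, smul_zero]
  set T : Module.End k V := Algebra.lsmul k k V τ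
  -- `L` will turn out to be a complement of the highest weight line and to contain every proper
  -- submodule.
  set L : Submodule k V := ⨆ ν, ⨆ (_ : ν ≠ μ), T.eigenspace ν
  have hdisj : Disjoint (T.eigenspace μ) L := T.eigenspaces_iSupIndep μ
  have hwd : ∀ l : List S, D.wordVec S v l ∈ T.eigenspace (μ * D.q ^ (-N * l.length)) := by
    intro l
    rw [Module.End.mem_eigenspace_iff]
    change τ • D.wordVec S v l = _
    induction l with
    | nil => simpa [wordVec] using hμ
    | cons i l ih =>
      have h1 : τ * D.leviF S i = D.q ^ (-N) • (D.leviF S i * τ) := Subtype.ext (ht.mul_F i)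
      rw [wordVec_cons, ← mul_smul, h1, smul_assoc, mul_smul, ih, smul_comm (D.leviF S i),
        smul_smul, mul_left_comm, ← zpow_add₀ D.q_ne_zero, List.length_cons]
      congr 3
      push_cast
      ring
  -- A word of length `r` has eigenvalue `μ q ^ (-N r)`, which equals `μ` only for `r = 0`; so `V =
  -- k v + L`.
  have hspan : ∀ x : V, ∃ c : k, x - c • v ∈ L := by
    intro x
    have hx : x ∈ Submodule.span k (Set.range (D.wordVec S v)) := by
      rw [span_wordVec_eq_top hv hE hK]; trivial
    induction hx using Submodule.span_induction with
    | mem x hx =>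
      obtain ⟨l, rfl⟩ := hx
      rcases l with _ | ⟨i, l⟩
      · exact ⟨1, by simp [wordVec]⟩
      · refine ⟨0, ?_⟩
        rw [zero_smul, sub_zero]
        refine Submodule.mem_iSup_of_mem _ (Submodule.mem_iSup_of_mem ?_ (hwd _))
        intro h
        have h1 := zpow_injective_of_pow_ne_one D.q_ne_zero D.q_pow_ne_one
          (show D.q ^ (-N * ((i :: l).length : ℤ)) = D.q ^ (0 : ℤ) by
            rw [zpow_zero]; exact mul_left_cancel₀ hμ0 (h.trans (mul_one μ).symm))
        rcases mul_eq_zero.mp h1 with h2 | h2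
        · omega
        · simp at h2
          omega
    | zero => exact ⟨0, by simp⟩
    | add x y _ _ hx hy =>
      obtain ⟨a, ha⟩ := hx
      obtain ⟨b, hb⟩ := hy
      exact ⟨a + b, by rw [add_smul, add_sub_add_comm]; exact L.add_mem ha hb⟩
    | smul c x _ hx =>
      obtain ⟨a, ha⟩ := hx
      exact ⟨c * a, by rw [mul_smul, ← smul_sub]; exact L.smul_mem c ha⟩
  have hvμ : v ∈ T.eigenspace μ := Module.End.mem_eigenspace_iff.mpr hμ
  have htop : ⨆ ν, T.eigenspace ν = ⊤ := by
    refine eq_top_iff.mpr fun x _ => ?_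
    obtain ⟨c, hc⟩ := hspan x
    rw [← sub_add_cancel x (c • v)]
    exact Submodule.add_mem _ ((show L ≤ _ from iSup_mono fun ν => iSup_const_le) hc)
      (Submodule.smul_mem _ _ (Submodule.mem_iSup_of_mem μ hvμ))
  -- A submodule is the sum of its intersections with the eigenspaces of `T`. The part for `μ` lies
  -- in `k v`, and it vanishes unless the submodule contains the generator `v`.
  have hle : ∀ P : Submodule (D.levi S) V, P ≠ ⊤ → P.restrictScalars k ≤ L := by
    intro P hP
    refine (le_iSup_inf_eigenspace (f := T) (μ := id) (fun x hx => P.smul_mem τ hx)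
      Function.injective_id htop).trans (iSup_le fun ν => ?_)
    rcases eq_or_ne ν μ with rfl | hν
    · intro y hy
      obtain ⟨c, hc⟩ := hspan y
      have h1 : y - c • v = 0 := by
        refine Submodule.disjoint_def.mp hdisj _ ?_ hc
        exact Submodule.sub_mem _ hy.2 (Submodule.smul_mem _ _ hvμ)
      rcases eq_or_ne c 0 with rfl | h0
      · rw [zero_smul, sub_zero] at h1; rw [h1]; exact L.zero_mem
      · refine absurd (eq_top_iff.mpr ?_) hP
        rw [← hv, Submodule.span_singleton_le_iff_mem]
        have h2 : c • v ∈ P.restrictScalars k := by rw [← sub_eq_zero.mp h1]; exact hy.1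
        exact (Submodule.smul_mem_iff _ h0).mp h2
    · exact inf_le_right.trans (le_iSup₂_of_le ν hν le_rfl)
  intro h
  have hvS : v ∈ sSup {P : Submodule (D.levi S) V | P ≠ ⊤} := by rw [h]; trivial
  have key : ∀ x ∈ sSup {P : Submodule (D.levi S) V | P ≠ ⊤}, x ∈ L := by
    intro x hx
    rw [sSup_eq_iSup'] at hx
    induction hx using Submodule.iSup_induction' with
    | mem P x hx => exact hle P.1 P.2 hx
    | zero => exact L.zero_mem
    | add x y _ _ hx hy => exact L.add_mem hx hy
  exact hv0 (Submodule.disjoint_def.mp hdisj v hvμ (key v hvS))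

end MaximalSubmodule

/-! ### Recognising the simple submodule, and the grading element. -/

/-- A simple module generated by a highest weight vector is the irreducible highest weight
module. -/
theorem nonempty_equiv_V {S : Set ι} {t t' : D.U} {N : ℤ} (hN : 0 < N)
    (ht : D.IsTorusElt t t' fun _ => N) {W : Type*} [AddCommGroup W] [Module k W]
    [Module (D.levi S) W] [IsScalarTower k (D.levi S) W] [IsSimpleModule (D.levi S) W]
    {m : ι → ℤ} {w : W} (hw : w ≠ 0) (hE : ∀ i, D.leviE S i • w = 0)
    (hK : ∀ j, D.leviK S j • w = D.q ^ ((D.d j : ℤ) * m j) • w) :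
    Nonempty (W ≃ₗ[D.levi S] D.V S m) := by
  let f : D.levi S →ₗ[D.levi S] W := LinearMap.toSpanSingleton (D.levi S) W w
  have hf : D.vermaIdeal S m ≤ LinearMap.ker f := by
    refine Submodule.span_le.mpr ?_
    rintro _ (⟨i, rfl⟩ | ⟨j, rfl⟩)
    · exact hE i
    · change (_ - _ : D.levi S) • w = 0
      rw [sub_smul, hK, algebraMap_smul, sub_self]
  let g : D.Verma S m →ₗ[D.levi S] W := (D.vermaIdeal S m).liftQ f hf
  let v : D.Verma S m := Submodule.Quotient.mk 1
  have hg : g v = w := by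
    change f 1 = w
    simp [f]
  have hg0 : g ≠ 0 := fun h => hw (by rw [← hg, h, LinearMap.zero_apply])
  have hsurj : Function.Surjective g := LinearMap.surjective_of_ne_zero hg0
  have hv : Submodule.span (D.levi S) {v} = ⊤ := by
    refine eq_top_iff.mpr fun x _ => ?_
    obtain ⟨a, rfl⟩ := Submodule.Quotient.mk_surjective _ x
    refine Submodule.mem_span_singleton.mpr ⟨a, ?_⟩
    rw [← Submodule.Quotient.mk_smul, smul_eq_mul, mul_one]
  have hvE : ∀ i, D.leviE S i • v = 0 := fun i => by
    rw [← Submodule.Quotient.mk_smul, smul_eq_mul, mul_one, Submodule.Quotient.mk_eq_zero]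
    exact Submodule.subset_span (Or.inl ⟨i, rfl⟩)
  have hvK : ∀ j, ∃ c : k, D.leviK S j • v = c • v := fun j => by
    refine ⟨D.q ^ ((D.d j : ℤ) * m j), ?_⟩
    rw [← algebraMap_smul (D.levi S) (D.q ^ ((D.d j : ℤ) * m j)) v, ← Submodule.Quotient.mk_smul,
      ← Submodule.Quotient.mk_smul, smul_eq_mul, mul_one, smul_eq_mul, mul_one,
      Submodule.Quotient.eq]
    exact Submodule.subset_span (Or.inr ⟨j, rfl⟩)
  have hne := sSup_proper_ne_top (V := D.Verma S m) hN ht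
    (fun h => hw (by rw [← hg, h, map_zero])) hv hvE hvK
  have hco : IsCoatom (LinearMap.ker g) := by
    rw [← isSimpleModule_iff_isCoatom]
    exact IsSimpleModule.congr (g.quotKerEquivOfSurjective hsurj)
  -- The kernel is proper, hence below the sum of all proper submodules; that sum is itself proper,
  -- so maximality of the kernel gives equality.
  have heq : sSup {P : Submodule (D.levi S) (D.Verma S m) | P ≠ ⊤} = LinearMap.ker g :=
    ((hco.le_iff.mp (le_sSup hco.1)).resolve_left hne)
  exact ⟨((Submodule.quotEquivOfEq _ _ heq).trans (g.quotKerEquivOfSurjective hsurj)).symm⟩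

variable (D) in
/-- If the Cartan matrix is nondegenerate, some monomial in the `K_j^{±1}` scales all `E_i` by the
same positive power of `q`. -/
theorem exists_isTorusElt_const [Fintype ι] [DecidableEq ι] (h : D.A.det ≠ 0) :
    ∃ N : ℤ, 0 < N ∧ ∃ t t', D.IsTorusElt t t' fun _ => N := by
  set u : ι → ℤ := Matrix.vecMul 1 D.A.adjugate
  have hu : ∀ i, ∑ j, u j * D.A j i = D.A.det := fun i => by
    have : Matrix.vecMul u D.A = D.A.det • 1 := by
      rw [Matrix.vecMul_vecMul, Matrix.adjugate_mul, Matrix.vecMul_smul, Matrix.vecMul_one]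
    simpa [Matrix.vecMul, dotProduct] using congrFun this i
  -- The omitted factor `d j` is supplied by the exponent `d j * A j i`, so each sum is the product
  -- of all `d l` times a multiple of `∑ u j * A j i = det A`. The extra `det A` turns this into a
  -- square and makes `N` positive.
  set c : ι → ℤ := fun j => (∏ l ∈ Finset.univ.erase j, (D.d l : ℤ)) * (u j * D.A.det)
  obtain ⟨t, t', ht⟩ := IsTorusElt.exists_sum (D := D) c
  refine ⟨(∏ l, (D.d l : ℤ)) * (D.A.det * D.A.det), mul_pos (Finset.prod_pos fun l _ => ?_)
    (mul_self_pos.mpr h), t, t', ?_⟩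
  · exact_mod_cast D.d_pos l
  · convert! ht using 1
    funext i
    have : ∀ j, c j * ((D.d j : ℤ) * D.A j i) =
        (∏ l, (D.d l : ℤ)) * D.A.det * (u j * D.A j i) := fun j => by
      rw [← Finset.mul_prod_erase _ _ (Finset.mem_univ j)]
      simp only [c]
      ring
    simp only [Finset.sum_apply, Pi.smul_apply, smul_eq_mul, this]
    rw [← Finset.mul_sum, hu, mul_assoc]

theorem finiteDimensional_of_le {S : Set ι} {P Q : Submodule (D.levi S) D.Adj} (h : P ≤ Q)
    [FiniteDimensional k Q] : FiniteDimensional k P := by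
  have : FiniteDimensional k (Q.restrictScalars k) := ‹FiniteDimensional k Q›
  exact Submodule.finiteDimensional_of_le (S₁ := P.restrictScalars k) (S₂ := Q.restrictScalars k) h

/-- The only content is that a generator of a submodule of `M(v)` is automatically locally finite.
-/
theorem interval_eq {S : Set ι} {v : D.Adj} (hv : v ∈ D.locallyFinite S) :
    D.interval S v = {N | N ≤ D.M S v ∧ ∃ w : D.Adj, N = Submodule.span (D.levi S) {w}} := by
  have : FiniteDimensional k (D.M S v) := hv
  ext N
  constructor
  · rintro ⟨⟨w, -, rfl⟩, hle⟩
    exact ⟨hle, w, rfl⟩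
  · rintro ⟨hle, w, rfl⟩
    exact ⟨⟨w, finiteDimensional_of_le hle, rfl⟩, hle⟩

/-- A nonzero finite-dimensional submodule contains an irreducible cyclic submodule generated by a
highest weight vector. -/
theorem exists_simple_le [Fintype ι] [DecidableEq ι] (h : D.A.det ≠ 0) {S : Set ι}
    {Q : Submodule (D.levi S) D.Adj} [FiniteDimensional k Q] (hQ : Q ≠ ⊥) :
    ∃ m : ι → ℤ, (∀ i ∈ S, 0 ≤ m i) ∧ ∃ w, D.M S w ≤ Q ∧ IsSimpleModule (D.levi S) (D.M S w) ∧
      Nonempty (D.M S w ≃ₗ[D.levi S] D.V S m) := by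
  obtain ⟨N, hN, t, t', ht⟩ := D.exists_isTorusElt_const h
  -- Finite dimension over `k` gives the descending chain condition, hence an atom `R` among the
  -- submodules of `Q`; its image `P` in `D.Adj` is simple.
  have : IsArtinian (D.levi S) Q := isArtinian_of_tower k inferInstance
  have hQ' : Nontrivial Q := Submodule.nontrivial_iff_ne_bot.mpr hQ
  obtain ⟨R, hR, -⟩ := (eq_bot_or_exists_atom_le (⊤ : Submodule (D.levi S) Q)).resolve_left
    top_ne_bot
  have hPQ : R.map Q.subtype ≤ Q := Submodule.map_subtype_le Q R
  set P := R.map Q.subtype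
  have hsimple : IsSimpleModule (D.levi S) P := by
    have := isSimpleModule_iff_isAtom.mpr hR
    exact IsSimpleModule.congr (N := R)
      (Submodule.equivMapOfInjective _ Q.injective_subtype R).symm
  have hPfin : FiniteDimensional k P := finiteDimensional_of_le hPQ
  have hPatom : IsAtom P := isSimpleModule_iff_isAtom.mp hsimple
  obtain ⟨m, w, hwP, hw0, hE, hK, hm⟩ := exists_highest_weight_vector hN ht P hPatom.1
  -- Any nonzero vector generates a simple module.
  have hMP : D.M S w = P := by
    refine (hPatom.le_iff.mp ((Submodule.span_singleton_le_iff_mem w P).mpr hwP)).resolve_left ?_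
    exact mt Submodule.span_singleton_eq_bot.mp hw0
  refine ⟨m, hm, w, hMP ▸ hPQ, hMP ▸ hsimple, ?_⟩
  rw [hMP]
  exact nonempty_equiv_V hN ht (w := (⟨w, hwP⟩ : P)) (fun h => hw0 (congrArg Subtype.val h))
    (fun i => Subtype.ext (hE i i.2)) (fun j => Subtype.ext (hK j))

end Datum

/-! ### Integral weights and the Cartan matrix of `𝔤`. -/

section Lie

open LieAlgebra LieAlgebra.IsKilling

variable {𝔤 : Type*} [LieRing 𝔤] [LieAlgebra ℂ 𝔤] [FiniteDimensional ℂ 𝔤]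
  [LieAlgebra.IsSemisimple ℂ 𝔤] {H : LieSubalgebra ℂ 𝔤} [H.IsCartanSubalgebra]
  (b : (rootSystem H).Base)

/-- Turns the exponents of a highest weight vector into an actual weight. Simple coroots are
linearly independent, so a functional with the given values exists on their span and extends to `H`.
As `coord` is defined by choice, its value is recovered from injectivity of `ℤ → ℂ`. -/
theorem exists_coord_eq (m : b.support → ℤ) : ∃ l : weightLattice b, coord b l = m := by
  have hli : LinearIndependent ℂ fun i : b.support => (rootSystem H).coroot i :=
    b.linearIndepOn_coroot
  obtain ⟨φ, hφ⟩ : ∃ φ : Module.Dual ℂ H, ∀ i : b.support, φ ((rootSystem H).coroot i) = m i := by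
    set B := Module.Basis.span hli
    obtain ⟨φ, hφ⟩ := (B.constr ℂ fun i => (m i : ℂ)).exists_extend
    refine ⟨φ, fun i => ?_⟩
    have h1 : (B i : H) = (rootSystem H).coroot i :=
      congrArg Subtype.val (Module.Basis.span_apply hli i)
    rw [← h1, ← B.constr_basis ℂ (fun i => (m i : ℂ)) i, ← hφ]
    rfl
  refine ⟨⟨φ, fun i => ⟨m i, hφ i⟩⟩, funext fun i => ?_⟩
  have := coord_spec b ⟨φ, fun i => ⟨m i, hφ i⟩⟩ i
  rw [hφ] at this
  exact_mod_cast this.symm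

/-- The matrix of `datum` is the transpose of `b.cartanMatrix`, which is nondegenerate; this is what
yields the grading element. -/
theorem datum_det_ne_zero (d : b.support → ℕ) (hd : ∀ i, 0 < d i)
    (hs : ∀ i j, (d i : ℤ) * b.cartanMatrix j i = d j * b.cartanMatrix i j)
    {k : Type*} [Field k] (q : k) (hq : q ≠ 0) (hr : ∀ n : ℕ, 0 < n → q ^ n ≠ 1)
    [DecidableEq b.support] : (datum b d hd hs q hq hr).A.det ≠ 0 := by
  have h := b.cartanMatrix_nondegenerate
  rw [Matrix.nondegenerate_iff_det_ne_zero, ← Matrix.det_transpose] at h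
  exact h

end Lie

end QGroup

theorem mainTheorem6 {𝔤 : Type*} [LieRing 𝔤] [LieAlgebra ℂ 𝔤] [FiniteDimensional ℂ 𝔤]
    [LieAlgebra.IsSemisimple ℂ 𝔤] {H : LieSubalgebra ℂ 𝔤} [H.IsCartanSubalgebra]
    (b : (LieAlgebra.IsKilling.rootSystem H).Base)
    (d : b.support → ℕ) (hd : ∀ i, 0 < d i)
    (hs : ∀ i j, (d i : ℤ) * b.cartanMatrix j i = d j * b.cartanMatrix i j)
    {k : Type*} [Field k] [CharZero k] (q : k) (hq : q ≠ 0) (hr : ∀ n : ℕ, 0 < n → q ^ n ≠ 1)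
    (S : Set b.support)
    (v : (QGroup.datum b d hd hs q hq hr).Adj)
    (hv : v ∈ (QGroup.datum b d hd hs q hq hr).locallyFinite S) :
    let D := QGroup.datum b d hd hs q hq hr
    D.interval S v = {N | N ≤ D.M S v ∧ ∃ w : D.Adj, N = Submodule.span (D.levi S) {w}} ∧
    (v ≠ 0 →
      ∃ l ∈ QGroup.LambdaS b D S, ∃ w ∈ D.locallyFinite S,
        D.M S w ≤ D.M S v ∧ IsSimpleModule (D.levi S) (D.M S w) ∧
          QGroup.IsEmbeddingOfType b D S l (D.M S w)) := by
  classical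
  intro D
  refine ⟨QGroup.Datum.interval_eq hv, fun hv0 => ?_⟩
  have : FiniteDimensional k (D.M S v) := hv
  obtain ⟨m, hm, w, hle, hsimple, he⟩ := QGroup.Datum.exists_simple_le (D := D)
    (QGroup.datum_det_ne_zero b d hd hs q hq hr) (Q := D.M S v)
    (by rwa [ne_eq, QGroup.Datum.M, Submodule.span_singleton_eq_bot])
  obtain ⟨l, rfl⟩ := QGroup.exists_coord_eq b m
  have hw : w ∈ D.locallyFinite S := QGroup.Datum.finiteDimensional_of_le hle
  exact ⟨l, ⟨hm, w, hw, he⟩, w, hw, hle, hsimple, he⟩
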